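/- Let $d\ge 0$, let $H:\mathbb{R}\times\mathbb{R}^d\times(\mathbb{R}^d)^*\to\mathbb{R}$, $(t,q,p)\mapsto H(t,q,p)$, be a $C^2$ function, and assume that there is a constant $M\ge 0$ such that $\|d^2H(t,q,p)\|\le M$ for all $(t,q,p)$, where $d^2H$ is the full second differential and $\|\cdot\|$ is the norm of bilinear forms associated with the Euclidean norm. Let $u_0:\mathbb{R}^d\to\mathbb{R}$ be of class $C^{1,1}$, i.e. differentiable with Lipschitz differential $du_0$, and let $\mathrm{Lip}(\cdot)$ denote the best Lipschitz constant. Set $$T=\Big(4M\big(1+\mathrm{Lip}(du_0)\big)\Big)^{-1}\in\,]0,\infty]$$ (so $T=\infty$ if $M=0$). Then $T>0$ and there exists a function $u:\,]-T,T[\,\times\mathbb{R}^d\to\mathbb{R}$ of class $C^{1,1}_{loc}$ (differentiable with locally Lipschitz differential) such that $$\partial_t u(t,q)+H\big(t,q,\partial_q u(t,q)\big)=0\quad\text{on } ]-T,T[\,\times\mathbb{R}^d,\qquad u(0,q)=u_0(q)\ \text{ for all } q\in\mathbb{R}^d.$$ Moreover, $u$ extends continuously to $\{(t,q)\in\mathbb{R}\times\mathbb{R}^d:|t|\le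 T\}$ and, for every $t\in\mathbb{R}$ with $|t|\le T$, the function $u_t=u(t,\cdot)$ is differentiable on $\mathbb{R}^d$ with $$\mathrm{Lip}(du_t)\le \mathrm{Lip}(du_0)+4|t|M\big(1+\mathrm{Lip}(du_0)\big)^2.$$ If in addition $u_0$ is $C^2$, then this solution $u$ is $C^2$ on $]-T,T[\,\times\mathbb{R}^d$. -/

import Mathlib

open scoped NNReal ENNReal

noncomputable section

namespace HJ

/-- The configuration space `ℝ^d` with its Euclidean norm. -/
abbrev Pos (d : ℕ) : Type := EuclideanSpace ℝ (Fin d)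

/-- The space of momenta `(ℝ^d)^*` with the dual norm. -/
abbrev Mom (d : ℕ) : Type := StrongDual ℝ (EuclideanSpace ℝ (Fin d))

/-- The Euclidean norm of a vector `(τ, θ, ζ)` of `ℝ × ℝ^d × (ℝ^d)^*`
(the default norm of a product in Mathlib is the maximum norm). -/
def euclNorm {d : ℕ} (v : ℝ × Pos d × Mom d) : ℝ :=
  Real.sqrt (‖v.1‖ ^ 2 + ‖v.2.1‖ ^ 2 + ‖v.2.2‖ ^ 2)

/-- `‖d²H(z)‖ ≤ M` for every `z = (t, q, p)`, where `‖·‖` is the norm of a bilinear form with respect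
to the Euclidean norm. -/
def HessianBoundedBy {d : ℕ} (H : ℝ × Pos d × Mom d → ℝ) (M : ℝ≥0) : Prop :=
  ∀ z v w : ℝ × Pos d × Mom d,
    |fderiv ℝ (fderiv ℝ H) z v w| ≤ M * euclNorm v * euclNorm w

/-- The best Lipschitz constant of a map (equal to `∞` if the map is not Lipschitz). -/
def lip {X Y : Type*} [PseudoEMetricSpace X] [PseudoEMetricSpace Y] (f : X → Y) : ℝ≥0∞ :=
  ⨅ (K : ℝ≥0) (_ : LipschitzWith K f), (K : ℝ≥0∞)

/-- A function of class `C^{1,1}`: differentiable, with Lipschitz differential. -/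
def IsC11 {V : Type*} [NormedAddCommGroup V] [NormedSpace ℝ V] (f : V → ℝ) : Prop :=
  Differentiable ℝ f ∧ ∃ K : ℝ≥0, LipschitzWith K (fderiv ℝ f)

/-- A function of class `C^{1,1}_loc` on an (open) set `Ω`: differentiable at each point of `Ω`, with
locally Lipschitz differential on `Ω`. -/
def IsC11LocOn {V : Type*} [NormedAddCommGroup V] [NormedSpace ℝ V] (f : V → ℝ) (Ω : Set V) :
    Prop :=
  (∀ z ∈ Ω, DifferentiableAt ℝ f z) ∧ LocallyLipschitzOn Ω (fderiv ℝ f)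

/-- The strip `]-T, T[ × ℝ^d`, where `T ∈ [0, ∞]`. -/
def strip (d : ℕ) (T : ℝ≥0∞) : Set (ℝ × Pos d) := {z | ‖z.1‖ₑ < T}

/-- The closed strip `{(t, q) : |t| ≤ T}`, where `T ∈ [0, ∞]`. -/
def closedStrip (d : ℕ) (T : ℝ≥0∞) : Set (ℝ × Pos d) := {z | ‖z.1‖ₑ ≤ T}

/-- `u` satisfies `∂_t u + H(t, q, ∂_q u) = 0` at every point of `Ω`. -/
def SolvesHJOn {d : ℕ} (H : ℝ × Pos d × Mom d → ℝ) (u : ℝ × Pos d → ℝ) (Ω : Set (ℝ × Pos d)) :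
    Prop :=
  ∀ t q, (t, q) ∈ Ω →
    deriv (fun s : ℝ => u (s, q)) t + H (t, q, fderiv ℝ (fun y : Pos d => u (t, y)) q) = 0

end HJ

end

/-! The proof is the method of characteristics. On phase space, with the maximum norm, the
Hamiltonian field `X = (∂_p H, -∂_q H)` is Lipschitz in space with constant `K = 71/50 * M`, since
`71/50` exceeds `√2`. Let `Z` be its flow and `F t a` the position at time `t` of the orbit issued
from `(a, du₀(a))`. By Grönwall, `F t - id` is Lipschitz with constant `ε = (exp (K|t|) - 1)(1 +
L)`, where `L = Lip(du₀)`. This is at most `3/4` on the open set `J` of times with `K|t|(1 + L) <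
1/2`, so there `F t` is a bijection, with inverse `S t`.

The value `u (t, q)` is `u₀` at the starting point plus the action along the characteristic that
reaches `q` at time `t`, and `p (t, q)` is its final momentum. Since `du₀` is only Lipschitz, `F`
and `S` need not be differentiable and the chain rule is unavailable. Instead, `abs_action_sub_le`
compares the actions of two orbits: Hamilton's equations cancel the first order terms, and the error
is quadratic. Hence `u` agrees, up to a quadratic error, with a differentiable model built on one
fixed characteristic, which gives `du = -H dt + p dq`, and so the equation.

Regularity of `u` is then read off `p`: it is locally Lipschitz because the flow is `C¹` and `S` is
locally Lipschitz, and it is `C¹` by the inverse function theorem when `u₀` is `C²`. The bound `(L +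
ε)/(1 - ε)` on `Lip(du_t)` becomes the stated one by elementary estimates. Since `|t| ≤ T` lies
inside `J`, the solution exists past the closed strip and the extension to its boundary is
automatic. -/

open scoped Topology
open Set Filter

/-! ### Grönwall estimates and existence for Lipschitz fields -/

section ODE

variable {E : Type*} [NormedAddCommGroup E] [NormedSpace ℝ E]

/-- Two-sided Grönwall inequality around the time `0`. -/
theorem norm_le_gronwallBound_abs {f f' : ℝ → E} {δ K ε t : ℝ}
    (hf : ∀ s, |s| ≤ |t| → HasDerivAt f (f' s) s)
    (hb : ∀ s, |s| ≤ |t| → ‖f' s‖ ≤ K * ‖f s‖ + ε) (h0 : ‖f 0‖ ≤ δ) :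
    ‖f t‖ ≤ gronwallBound δ K ε |t| := by
  rcases le_total 0 t with ht | ht
  · rw [abs_of_nonneg ht] at hf hb ⊢
    have h := norm_le_gronwallBound_of_norm_deriv_right_le (f := f) (f' := f') (δ := δ) (K := K)
      (ε := ε) (a := 0) (b := t)
      (fun s hs => (hf s (by rw [abs_of_nonneg hs.1]; exact hs.2)).continuousAt.continuousWithinAt)
      (fun s hs => (hf s (by rw [abs_of_nonneg hs.1]; exact hs.2.le)).hasDerivWithinAt) h0
      (fun s hs => hb s (by rw [abs_of_nonneg hs.1]; exact hs.2.le)) t ⟨ht, le_rfl⟩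
    simpa using h
  · rw [abs_of_nonpos ht] at hf hb ⊢
    have hd : ∀ s, 0 ≤ s → s ≤ -t → HasDerivAt (fun r => f (-r)) (-f' (-s)) s := by
      intro s hs hst
      have := (hf (-s) (by rw [abs_neg, abs_of_nonneg hs]; exact hst)).scomp s (hasDerivAt_neg s)
      simpa [Function.comp_def] using this
    have h := norm_le_gronwallBound_of_norm_deriv_right_le (f := fun r => f (-r))
      (f' := fun s => -f' (-s)) (δ := δ) (K := K) (ε := ε) (a := 0) (b := -t)
      (fun s hs => (hd s hs.1 hs.2).continuousAt.continuousWithinAt)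
      (fun s hs => (hd s hs.1 hs.2.le).hasDerivWithinAt) (by simpa using h0)
      (fun s hs => by
        rw [norm_neg]
        exact hb (-s) (by rw [abs_neg, abs_of_nonneg hs.1]; exact hs.2.le)) (-t)
      ⟨by linarith, le_rfl⟩
    simpa using h

theorem gronwallBound_zero_mul (K δ t : ℝ) :
    gronwallBound 0 K (K * δ) t = (Real.exp (K * t) - 1) * δ := by
  by_cases hK : K = 0
  · simp [hK, gronwallBound_K0]
  · rw [gronwallBound_of_K_ne_0 hK]
    field_simp
    ring

/-- A vector field which is `K`-Lipschitz in space has integral curves on the whole time interval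
`K * |t| < c`, if `c < 1`. -/
theorem exists_hasDerivAt_of_lipschitzWith [CompleteSpace E] {f : ℝ → E → E} {K : ℝ≥0} {c : ℝ}
    (hc0 : 0 < c) (hc1 : c < 1) (hlip : ∀ t : ℝ, K * |t| ≤ c → LipschitzWith K (f t))
    (hcont : ∀ x, ContinuousOn (fun t => f t x) {t | K * |t| ≤ c}) (x₀ : E) :
    ∃ α : ℝ → E, α 0 = x₀ ∧ ∀ t : ℝ, K * |t| < c → HasDerivAt α (f t (α t)) t := by
  -- For `K = 0` the time interval is the whole line and `c / K` is the default value `0`; but the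
  -- field does not depend on position, so a primitive solves the equation.
  rcases eq_or_ne K 0 with rfl | hK
  · have hct : Continuous fun t => f t x₀ := by
      have := hcont x₀
      simpa [hc0.le, continuousOn_univ] using this
    refine ⟨fun t => x₀ + ∫ s in (0 : ℝ)..t, f s x₀, by simp, fun t _ => ?_⟩
    have h1 := (hct.integral_hasStrictDerivAt 0 t).hasDerivAt.const_add x₀
    convert h1 using 1
    have := (hlip t (by simpa using hc0.le)).dist_le_mul
      (x₀ + ∫ s in (0 : ℝ)..t, f s x₀) x₀
    simpa using this
  · have hKp : (0 : ℝ) < K := by positivity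
    set τ : ℝ := c / K with hτ
    have hτ0 : 0 < τ := by positivity
    have hKτ : K * τ = c := by rw [hτ]; field_simp
    have hmem : ∀ t ∈ Icc (-τ) τ, (K : ℝ) * |t| ≤ c := fun t ht => by
      rw [← hKτ]
      exact mul_le_mul_of_nonneg_left (abs_le.2 ht) hKp.le
    obtain ⟨C, hC⟩ := isCompact_Icc.exists_bound_of_continuousOn
      ((hcont x₀).mono (show Icc (-τ) τ ⊆ {t | (K : ℝ) * |t| ≤ c} from hmem))
    have hC0 : 0 ≤ C := (norm_nonneg _).trans (hC 0 ⟨by linarith, hτ0.le⟩)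
    -- The radius `a` solves `(C + K * a) * τ = a`: a curve of speed at most `C + K * a` stays in
    -- the ball of radius `a` up to time `τ`. This is where `c < 1` is needed.
    set a : ℝ := C * τ / (1 - c) with ha
    have h1c : 0 < 1 - c := by linarith
    have ha0 : 0 ≤ a := by positivity
    have hP : IsPicardLindelof f (tmin := -τ) (tmax := τ) ⟨0, by constructor <;> linarith⟩ x₀
        ⟨a, ha0⟩ 0 ⟨C + K * a, by positivity⟩ K := by
      refine ⟨fun t ht => (hlip t (hmem t ht)).lipschitzOnWith,
        fun x _ => (hcont x).mono hmem, fun t ht x hx => ?_, ?_⟩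
      · have h1 := (hlip t (hmem t ht)).dist_le_mul x x₀
        rw [dist_eq_norm] at h1
        have h2 : dist x x₀ ≤ a := hx
        calc ‖f t x‖ = ‖f t x₀ + (f t x - f t x₀)‖ := by congr 1; abel
          _ ≤ ‖f t x₀‖ + ‖f t x - f t x₀‖ := norm_add_le _ _
          _ ≤ C + K * a := add_le_add (hC t ht) (h1.trans (by gcongr))
      · have : (C + K * a) * τ = a := by
          have : (C + K * a) * τ = C * τ + (K * τ) * a := by ring
          rw [this, hKτ, ha]
          field_simp
          ring
        simp only [sub_zero, zero_sub, neg_neg, max_self, NNReal.coe_zero]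
        exact this.le
    obtain ⟨α, hα0, hα⟩ := hP.exists_eq_forall_mem_Icc_hasDerivWithinAt₀
    refine ⟨α, hα0, fun t ht => ?_⟩
    have htτ : |t| < τ := by
      rw [hτ, lt_div_iff₀ hKp]; linarith
    rw [abs_lt] at htτ
    exact (hα t ⟨htτ.1.le, htτ.2.le⟩).hasDerivAt (Icc_mem_nhds htτ.1 htτ.2)

/-- Trajectories of a `K`-Lipschitz vector field: the displacement is Lipschitz. -/
theorem norm_sub_sub_le_of_trajectories {f : ℝ → E → E} {K : ℝ≥0} {t : ℝ} {α β : ℝ → E}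
    (hlip : ∀ s : ℝ, |s| ≤ |t| → LipschitzWith K (f s))
    (hα : ∀ s : ℝ, |s| ≤ |t| → HasDerivAt α (f s (α s)) s)
    (hβ : ∀ s : ℝ, |s| ≤ |t| → HasDerivAt β (f s (β s)) s) :
    ‖α t - β t - (α 0 - β 0)‖ ≤ (Real.exp (K * |t|) - 1) * ‖α 0 - β 0‖ := by
  -- Grönwall is applied to the difference of displacements, which vanishes at time `0` and whose
  -- derivative is at most `K` times itself plus `K * ‖α 0 - β 0‖`.
  rw [← gronwallBound_zero_mul]
  refine norm_le_gronwallBound_abs (f := fun s => α s - β s - (α 0 - β 0))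
    (f' := fun s => f s (α s) - f s (β s)) (fun s hs => ((hα s hs).sub (hβ s hs)).sub_const _)
    (fun s hs => ?_) (by simp)
  have h1 := (hlip s hs).dist_le_mul (α s) (β s)
  rw [dist_eq_norm, dist_eq_norm] at h1
  refine h1.trans ?_
  rw [← mul_add]
  gcongr
  calc ‖α s - β s‖ = ‖(α s - β s - (α 0 - β 0)) + (α 0 - β 0)‖ := by congr 1; abel
    _ ≤ _ := norm_add_le _ _

theorem norm_sub_le_of_trajectories {f : ℝ → E → E} {K : ℝ≥0} {t : ℝ} {α β : ℝ → E}
    (hlip : ∀ s : ℝ, |s| ≤ |t| → LipschitzWith K (f s))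
    (hα : ∀ s : ℝ, |s| ≤ |t| → HasDerivAt α (f s (α s)) s)
    (hβ : ∀ s : ℝ, |s| ≤ |t| → HasDerivAt β (f s (β s)) s) :
    ‖α t - β t‖ ≤ Real.exp (K * |t|) * ‖α 0 - β 0‖ := by
  have h := norm_sub_sub_le_of_trajectories hlip hα hβ
  calc ‖α t - β t‖ = ‖(α t - β t - (α 0 - β 0)) + (α 0 - β 0)‖ := by congr 1; abel
    _ ≤ ‖α t - β t - (α 0 - β 0)‖ + ‖α 0 - β 0‖ := norm_add_le _ _
    _ ≤ _ := by linarith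

end ODE

/-! ### Differentiability of the flow of a `C¹` field -/

section Flow

variable {E : Type*} [NormedAddCommGroup E] [NormedSpace ℝ E]

theorem gronwallBound_zero_left (K ε t : ℝ) :
    gronwallBound 0 K ε t = ε * gronwallBound 0 K 1 t := by
  by_cases hK : K = 0
  · simp [hK, gronwallBound_K0]
  · rw [gronwallBound_of_K_ne_0 hK, gronwallBound_of_K_ne_0 hK]
    ring

theorem exp_le_two_of_lt_half {x : ℝ} (hx : x < 1 / 2) : Real.exp x ≤ 2 := by
  have h1 : Real.exp x ≤ Real.exp (1 / 2) := Real.exp_le_exp.2 hx.le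
  have h2 : Real.exp (1 / 2) * Real.exp (1 / 2) = Real.exp 1 := by rw [← Real.exp_add]; norm_num
  nlinarith [Real.exp_one_lt_d9, Real.exp_pos (1 / 2)]

/-- `Z t x` is the position at time `t`, for `K * |t| < c`, of the integral curve of `X` starting
at `x` at time `0`. -/
structure IsFlowOf (X : ℝ × E → E) (K : ℝ≥0) (c : ℝ) (Z : ℝ → E → E) : Prop where
  zero : ∀ x, Z 0 x = x
  hasDerivAt : ∀ x (t : ℝ), K * |t| < c → HasDerivAt (fun s => Z s x) (X (t, Z t x)) t

theorem exists_isFlowOf [CompleteSpace E] {X : ℝ × E → E} {K : ℝ≥0} {c : ℝ} (hc0 : 0 < c)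
    (hc1 : c < 1) (hX : Continuous X) (hlip : ∀ t, LipschitzWith K fun x => X (t, x)) :
    ∃ Z, IsFlowOf X K c Z := by
  choose Z hZ0 hZ using fun x₀ => exists_hasDerivAt_of_lipschitzWith (f := fun t x => X (t, x)) hc0
    hc1 (fun t _ => hlip t)
    (fun x => (hX.comp (continuous_id.prodMk continuous_const)).continuousOn) x₀
  exact ⟨fun t x => Z x t, hZ0, hZ⟩

namespace IsFlowOf

variable {X : ℝ × E → E} {K : ℝ≥0} {c : ℝ} {Z : ℝ → E → E}

theorem norm_sub_sub_le (hZ : IsFlowOf X K c Z) (hlip : ∀ t, LipschitzWith K fun x => X (t, x))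
    {t : ℝ} (ht : K * |t| < c) (x y : E) :
    ‖Z t x - Z t y - (x - y)‖ ≤ (Real.exp (K * |t|) - 1) * ‖x - y‖ := by
  have hs : ∀ s : ℝ, |s| ≤ |t| → K * |s| < c := fun s hs =>
    (mul_le_mul_of_nonneg_left hs K.2).trans_lt ht
  have := norm_sub_sub_le_of_trajectories (f := fun t x => X (t, x)) (t := t)
    (fun s _ => hlip s) (fun s h => hZ.hasDerivAt x s (hs s h))
    (fun s h => hZ.hasDerivAt y s (hs s h))
  simpa [hZ.zero] using this

theorem norm_sub_le (hZ : IsFlowOf X K c Z) (hlip : ∀ t, LipschitzWith K fun x => X (t, x))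
    {t : ℝ} (ht : K * |t| < c) (ht' : K * |t| < 1 / 2) (x y : E) :
    ‖Z t x - Z t y‖ ≤ 2 * ‖x - y‖ := by
  have hs : ∀ s : ℝ, |s| ≤ |t| → K * |s| < c := fun s hs =>
    (mul_le_mul_of_nonneg_left hs K.2).trans_lt ht
  have := norm_sub_le_of_trajectories (f := fun t x => X (t, x)) (t := t)
    (fun s _ => hlip s) (fun s h => hZ.hasDerivAt x s (hs s h))
    (fun s h => hZ.hasDerivAt y s (hs s h))
  simp only [hZ.zero] at this
  exact this.trans (by gcongr; exact exp_le_two_of_lt_half ht')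

theorem isOpen_times (K : ℝ≥0) (c : ℝ) : IsOpen {t : ℝ | K * |t| < c} :=
  isOpen_lt (by fun_prop) continuous_const

theorem continuousAt (hZ : IsFlowOf X K c Z) (hlip : ∀ t, LipschitzWith K fun x => X (t, x))
    {t : ℝ} (ht : K * |t| < c) (ht' : K * |t| < 1 / 2) (x : E) :
    ContinuousAt (fun w : ℝ × E => Z w.1 w.2) (t, x) := by
  have h1 : Tendsto (fun w : ℝ × E => 2 * ‖w.2 - x‖ + ‖Z w.1 x - Z t x‖) (𝓝 (t, x)) (𝓝 0) := by
    have hc : ContinuousAt (fun w : ℝ × E => 2 * ‖w.2 - x‖ + ‖Z w.1 x - Z t x‖) (t, x) := by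
      have h2 : ContinuousAt (fun w : ℝ × E => Z w.1 x) (t, x) :=
        ContinuousAt.comp (f := fun w : ℝ × E => w.1) (x := (t, x))
          (hZ.hasDerivAt x t ht).continuousAt continuousAt_fst
      exact (continuousAt_const.mul (continuousAt_snd.sub continuousAt_const).norm).add
        (h2.sub continuousAt_const).norm
    simpa [ContinuousAt] using hc
  rw [ContinuousAt, tendsto_iff_norm_sub_tendsto_zero]
  refine squeeze_zero' (Eventually.of_forall fun _ => norm_nonneg _) ?_ h1
  have e1 := continuousAt_fst (p := (t, x)) ((isOpen_times K c).mem_nhds ht)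
  have e2 := continuousAt_fst (p := (t, x)) ((isOpen_times K (1 / 2)).mem_nhds ht')
  filter_upwards [e1, e2] with w hw hw'
  calc ‖Z w.1 w.2 - Z t x‖ = ‖(Z w.1 w.2 - Z w.1 x) + (Z w.1 x - Z t x)‖ := by congr 1; abel
    _ ≤ _ := (norm_add_le _ _).trans (by gcongr; exact hZ.norm_sub_le hlip hw hw' _ _)

/-- A continuous function varies little near a trajectory, uniformly on compact time intervals. -/
theorem exists_uniform_near {Y : Type*} [PseudoMetricSpace Y] {A : ℝ × E → Y} (hA : Continuous A)
    (hZ : IsFlowOf X K c Z) {τ : ℝ} (hτ : K * τ < c) (x : E) {η : ℝ} (hη : 0 < η) :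
    ∃ δ > 0, ∀ s : ℝ, |s| ≤ τ → ∀ y, ‖y - Z s x‖ < δ → dist (A (s, y)) (A (s, Z s x)) < η := by
  have hmem : ∀ s ∈ Icc (-τ) τ, K * |s| < c := fun s hs =>
    (mul_le_mul_of_nonneg_left (abs_le.2 hs) K.2).trans_lt hτ
  -- Only the arc of trajectory has to be compact, so local compactness of `E` plays no role.
  have hcomp : IsCompact ((fun s => (s, Z s x)) '' Icc (-τ) τ) :=
    isCompact_Icc.image_of_continuousOn (continuousOn_id.prodMk fun s hs =>
      (hZ.hasDerivAt x s (hmem s hs)).continuousAt.continuousWithinAt)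
  have h := hcomp.uniformContinuousAt_of_continuousAt A (fun a _ => hA.continuousAt)
    (Metric.dist_mem_uniformity hη)
  obtain ⟨δ, hδ, h⟩ := Metric.mem_uniformity_dist.1 h
  refine ⟨δ, hδ, fun s hs y hy => ?_⟩
  have := h (a := (s, Z s x)) (b := (s, y)) (by
    rw [Prod.dist_eq, dist_self, max_lt_iff]
    exact ⟨hδ, by rwa [dist_comm, dist_eq_norm]⟩) ⟨s, abs_le.1 hs, rfl⟩
  rw [dist_comm]
  exact this

/-- Variational equation along a flow. -/
structure IsLinearization (X : ℝ × E → E) (K : ℝ≥0) (c : ℝ) (Z : ℝ → E → E)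
    (W : ℝ → E → E →L[ℝ] E) : Prop where
  zero : ∀ x, W 0 x = ContinuousLinearMap.id ℝ E
  hasDerivAt : ∀ x (t : ℝ), K * |t| < c →
    HasDerivAt (fun s => W s x) (fderiv ℝ (fun y => X (t, y)) (Z t x) ∘L W t x) t

theorem fderiv_space_eq (hX : ContDiff ℝ 1 X) (t : ℝ) (x : E) :
    fderiv ℝ (fun y => X (t, y)) x = fderiv ℝ X (t, x) ∘L ContinuousLinearMap.inr ℝ ℝ E := by
  have h1 := ((hX.differentiable one_ne_zero) (t, x)).hasFDerivAt
  exact (h1.comp x (hasFDerivAt_prodMk_right t x)).fderiv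

theorem hasFDerivAt_space (hX : ContDiff ℝ 1 X) (t : ℝ) (x : E) :
    HasFDerivAt (fun y => X (t, y)) (fderiv ℝ (fun y => X (t, y)) x) x := by
  have h1 := ((hX.differentiable one_ne_zero) (t, x)).hasFDerivAt
  exact (h1.comp x (hasFDerivAt_prodMk_right t x)).differentiableAt.hasFDerivAt

theorem continuous_fderiv_space (hX : ContDiff ℝ 1 X) :
    Continuous fun w : ℝ × E => fderiv ℝ (fun y => X (w.1, y)) w.2 := by
  simp only [fderiv_space_eq hX]
  exact (hX.continuous_fderiv one_ne_zero).clm_comp continuous_const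

theorem exists_isLinearization [CompleteSpace E] (hX : ContDiff ℝ 1 X)
    (hlip : ∀ t, LipschitzWith K fun x => X (t, x)) {c' : ℝ} (hc0 : 0 < c') (hcc : c' < c)
    (hc1 : c' < 1) (hZ : IsFlowOf X K c Z) : ∃ W, IsLinearization X K c' Z W := by
  choose W hW0 hW using fun x => exists_hasDerivAt_of_lipschitzWith (E := E →L[ℝ] E) (K := K)
    (f := fun t w => fderiv ℝ (fun y => X (t, y)) (Z t x) ∘L w) hc0 hc1
    (fun t _ => LipschitzWith.of_dist_le_mul fun v w => by
      rw [dist_eq_norm, dist_eq_norm, ← ContinuousLinearMap.comp_sub]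
      refine (ContinuousLinearMap.opNorm_comp_le _ _).trans ?_
      gcongr
      exact norm_fderiv_le_of_lipschitz ℝ (hlip t))
    (fun w => by
      have h1 : ContinuousOn (fun t => (t, Z t x)) {t : ℝ | K * |t| ≤ c'} :=
        continuousOn_id.prodMk fun t ht =>
          (hZ.hasDerivAt x t (lt_of_le_of_lt ht hcc)).continuousAt.continuousWithinAt
      exact (((continuous_fderiv_space hX).comp_continuousOn h1)).clm_comp continuousOn_const)
    (ContinuousLinearMap.id ℝ E)
  exact ⟨fun t x => W x t, hW0, hW⟩

theorem IsLinearization.norm_le {W : ℝ → E → E →L[ℝ] E}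
    (hlip : ∀ t, LipschitzWith K fun x => X (t, x)) (hW : IsLinearization X K (1 / 2) Z W)
    {t : ℝ} (ht : K * |t| < 1 / 2) (x : E) : ‖W t x‖ ≤ 2 := by
  have h := norm_le_gronwallBound_abs (f := fun s => W s x) (δ := 1) (K := K) (ε := 0) (t := t)
    (fun s hs => hW.hasDerivAt x s ((mul_le_mul_of_nonneg_left hs K.2).trans_lt ht))
    (fun s hs => by
      rw [add_zero]
      refine (ContinuousLinearMap.opNorm_comp_le _ _).trans ?_
      gcongr
      exact norm_fderiv_le_of_lipschitz ℝ (hlip s))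
    (by rw [hW.zero]; exact ContinuousLinearMap.norm_id_le)
  rw [gronwallBound_ε0, one_mul] at h
  exact h.trans (exp_le_two_of_lt_half ht)

/-- First order expansion of the flow and continuity of its linearization, uniformly on compact
time intervals. -/
theorem eventually_expansion (hX : ContDiff ℝ 1 X)
    (hlip : ∀ t, LipschitzWith K fun x => X (t, x)) (hZ : IsFlowOf X K c Z) (hc : 1 / 2 ≤ c)
    {W : ℝ → E → E →L[ℝ] E} (hW : IsLinearization X K (1 / 2) Z W)
    {τ : ℝ} (hτ0 : 0 ≤ τ) (hτ : K * τ < 1 / 2) (x : E) {η : ℝ} (hη : 0 < η) :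
    ∀ᶠ y in 𝓝 x, ∀ t : ℝ, |t| ≤ τ →
      ‖Z t y - Z t x - W t x (y - x)‖ ≤ η * ‖y - x‖ ∧ ‖W t y - W t x‖ ≤ η := by
  set G := gronwallBound 0 K 1 τ with hG
  have hG0 : 0 ≤ G := by
    have := gronwallBound_mono (K := K) le_rfl zero_le_one K.2 hτ0
    rwa [gronwallBound_x0] at this
  have hGt : ∀ t : ℝ, |t| ≤ τ → gronwallBound 0 K 1 |t| ≤ G := fun t ht =>
    gronwallBound_mono (K := K) le_rfl zero_le_one K.2 ht
  -- The `2` absorbs the Lipschitz constant of the flow and the bound on `W`; `G` is the Grönwall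
  -- factor, with `+ 1` to avoid dividing by zero.
  set ρ := η / (2 * (G + 1)) with hρ
  have hρ0 : 0 < ρ := by positivity
  have hρG : ∀ t : ℝ, |t| ≤ τ → ρ * 2 * gronwallBound 0 K 1 |t| ≤ η := fun t ht => by
    calc ρ * 2 * gronwallBound 0 K 1 |t| ≤ ρ * 2 * (G + 1) := by
          gcongr; linarith [hGt t ht]
      _ = η := by rw [hρ]; field_simp
  obtain ⟨δ, hδ, hnear⟩ := exists_uniform_near (continuous_fderiv_space hX) hZ
    (hτ.trans_le hc) x hρ0
  have htime : ∀ s : ℝ, |s| ≤ τ → K * |s| < 1 / 2 := fun s hs =>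
    (mul_le_mul_of_nonneg_left hs K.2).trans_lt hτ
  filter_upwards [Metric.ball_mem_nhds x (half_pos hδ)] with y hy t ht
  have hyx : ‖y - x‖ < δ / 2 := by rwa [← dist_eq_norm]
  have hZyx : ∀ s : ℝ, |s| ≤ τ → ‖Z s y - Z s x‖ ≤ 2 * ‖y - x‖ := fun s hs =>
    hZ.norm_sub_le hlip ((htime s hs).trans_le hc) (htime s hs) y x
  refine ⟨?_, ?_⟩
  · have h := norm_le_gronwallBound_abs (f := fun s => Z s y - Z s x - W s x (y - x)) (δ := 0)
      (K := K) (ε := ρ * 2 * ‖y - x‖) (t := t)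
      (fun s hs => (((hZ.hasDerivAt y s ((htime s (hs.trans ht)).trans_le hc)).sub
        (hZ.hasDerivAt x s ((htime s (hs.trans ht)).trans_le hc)))).sub
        ((hW.hasDerivAt x s (htime s (hs.trans ht))).clm_apply
          (hasDerivAt_const s (y - x)))) (fun s hs => ?_) (by simp [hZ.zero, hW.zero])
    · rw [gronwallBound_zero_left] at h
      calc _ ≤ _ := h
        _ = (ρ * 2 * gronwallBound 0 K 1 |t|) * ‖y - x‖ := by ring
        _ ≤ _ := by gcongr; exact hρG t ht
    · have hs' := hs.trans ht
      set A := fderiv ℝ (fun y => X (s, y)) (Z s x) with hA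
      -- The derivative of the error is the linearized field applied to the error, plus the Taylor
      -- remainder of `X`.
      have e : X (s, Z s y) - X (s, Z s x) - ((A ∘L W s x) (y - x) + W s x 0)
          = A (Z s y - Z s x - W s x (y - x))
            + (X (s, Z s y) - X (s, Z s x) - A (Z s y - Z s x)) := by
        simp only [map_sub, ContinuousLinearMap.comp_apply, map_zero]
        abel
      rw [e]
      refine (norm_add_le _ _).trans (add_le_add ?_ ?_)
      · refine (A.le_opNorm _).trans ?_
        gcongr
        exact norm_fderiv_le_of_lipschitz ℝ (hlip s)
      · have h1 := (convex_ball (Z s x) δ).norm_image_sub_le_of_norm_hasFDerivWithin_le'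
          (f := fun y => X (s, y)) (f' := fun y => fderiv ℝ (fun y => X (s, y)) y) (φ := A) (C := ρ)
          (fun z _ => (hasFDerivAt_space hX s z).hasFDerivWithinAt)
          (fun z hz => by
            have := hnear s hs' z (by rwa [← dist_eq_norm])
            rw [dist_eq_norm] at this
            exact this.le) (Metric.mem_ball_self hδ)
          (y := Z s y) (by rw [Metric.mem_ball, dist_eq_norm]; linarith [hZyx s hs'])
        refine h1.trans ?_
        rw [mul_assoc]
        gcongr
        exact hZyx s hs'
  · have h := norm_le_gronwallBound_abs (f := fun s => W s y - W s x) (δ := 0)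
      (K := K) (ε := ρ * 2) (t := t)
      (fun s hs => (hW.hasDerivAt y s (htime s (hs.trans ht))).sub
        (hW.hasDerivAt x s (htime s (hs.trans ht)))) (fun s hs => ?_) (by simp [hW.zero])
    · rw [gronwallBound_zero_left] at h
      exact h.trans (hρG t ht)
    · have hs' := hs.trans ht
      set A := fderiv ℝ (fun y => X (s, y)) (Z s x) with hA
      set B := fderiv ℝ (fun y => X (s, y)) (Z s y) with hB
      have e : B ∘L W s y - A ∘L W s x = B ∘L (W s y - W s x) + (B - A) ∘L W s x := by
        ext v
        simp
      rw [e]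
      refine (norm_add_le _ _).trans (add_le_add ?_ ?_)
      · refine (ContinuousLinearMap.opNorm_comp_le _ _).trans ?_
        gcongr
        exact norm_fderiv_le_of_lipschitz ℝ (hlip s)
      · refine (ContinuousLinearMap.opNorm_comp_le _ _).trans ?_
        have h1 := hnear s hs' (Z s y) (by linarith [hZyx s hs'])
        rw [dist_eq_norm] at h1
        gcongr
        exact IsLinearization.norm_le hlip hW (htime s hs') x

/-- The flow of a `C¹` vector field is `C¹`. -/
theorem contDiffAt [CompleteSpace E] (hX : ContDiff ℝ 1 X)
    (hlip : ∀ t, LipschitzWith K fun x => X (t, x)) (hZ : IsFlowOf X K c Z) (hc : 1 / 2 < c)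
    {t : ℝ} (ht : K * |t| < 1 / 2) (x : E) :
    ContDiffAt ℝ 1 (fun w : ℝ × E => Z w.1 w.2) (t, x) := by
  obtain ⟨W, hW⟩ := exists_isLinearization hX hlip (c' := 1 / 2) (by norm_num) hc (by norm_num) hZ
  have hopen : IsOpen {w : ℝ × E | K * |w.1| < 1 / 2} :=
    (isOpen_times K (1 / 2)).preimage continuous_fst
  have hWd : ∀ (s : ℝ) (y : E), (K : ℝ) * |s| < 1 / 2 → HasFDerivAt (fun y => Z s y) (W s y) y := by
    intro s y hs
    refine .of_isLittleO (Asymptotics.isLittleO_iff.2 fun η hη => ?_)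
    filter_upwards [eventually_expansion hX hlip hZ hc.le hW (abs_nonneg s) hs y hη] with z hz
    exact (hz s le_rfl).1
  have hWc : ∀ w : ℝ × E, K * |w.1| < 1 / 2 → ContinuousAt (fun w : ℝ × E => W w.1 w.2) w := by
    rintro ⟨s, y⟩ hs
    -- A margin beyond `|s|` makes the estimate uniform over times near `s`, as joint continuity
    -- requires.
    obtain ⟨τ, hτs, hτ⟩ : ∃ τ : ℝ, |s| < τ ∧ K * τ < 1 / 2 := by
      have h1 : ∀ᶠ r in 𝓝[>] |s|, (K : ℝ) * r < 1 / 2 :=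
        nhdsWithin_le_nhds ((isOpen_lt (by fun_prop) continuous_const).mem_nhds
          (x := |s|) (s := {r : ℝ | K * r < 1 / 2}) hs)
      obtain ⟨r, hr1, hr2⟩ := (h1.and self_mem_nhdsWithin).exists
      exact ⟨r, hr2, hr1⟩
    rw [Metric.continuousAt_iff']
    intro η hη
    have e1 := eventually_expansion hX hlip hZ hc.le hW ((abs_nonneg s).trans hτs.le) hτ y
      (half_pos hη)
    have e2 : ∀ᶠ r in 𝓝 s, |r| ≤ τ :=
      (continuous_abs.continuousAt.eventually_lt continuousAt_const hτs).mono fun _ h => h.le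
    have e3 := Metric.continuousAt_iff'.1 (hW.hasDerivAt y s hs).continuousAt _ (half_pos hη)
    rw [nhds_prod_eq]
    filter_upwards [(e2.and e3).prod_mk e1] with w hw
    have h1 := (hw.2 w.1 hw.1.1).2
    have h2 := hw.1.2
    rw [← dist_eq_norm] at h1
    linarith [dist_triangle (W w.1 w.2) (W w.1 y) (W s y)]
  have hZc : ∀ w : ℝ × E, K * |w.1| < 1 / 2 →
      ContinuousAt (fun w : ℝ × E => ContinuousLinearMap.toSpanSingleton ℝ
        (X (w.1, Z w.1 w.2))) w := by
    rintro ⟨s, y⟩ hs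
    have h1 := hZ.continuousAt hlip (hs.trans hc) hs y
    have h2 : ContinuousAt (fun w : ℝ × E => X (w.1, Z w.1 w.2)) (s, y) :=
      hX.continuous.continuousAt.comp (continuousAt_fst.prodMk h1)
    exact (ContinuousLinearMap.toSpanSingletonCLE (𝕜 := ℝ) (E := E)).continuous.continuousAt.comp h2
  have hst : ∀ w : ℝ × E, K * |w.1| < 1 / 2 → HasFDerivAt (fun w : ℝ × E => Z w.1 w.2)
      (ContinuousLinearMap.toSpanSingleton ℝ (X (w.1, Z w.1 w.2)) ∘L ContinuousLinearMap.fst ℝ ℝ E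
        + W w.1 w.2 ∘L ContinuousLinearMap.snd ℝ ℝ E) w := by
    intro w hw
    refine (hasStrictFDerivAt_uncurry_coprod (u := w) (f := Z)
      (f₁ := fun s y => ContinuousLinearMap.toSpanSingleton ℝ (X (s, Z s y)))
      (f₂ := W) ?_ ?_ (hZc w hw) (hWc w hw)).hasFDerivAt
    · filter_upwards [hopen.mem_nhds hw] with v hv
      exact (hZ.hasDerivAt v.2 v.1 (lt_trans hv hc)).hasFDerivAt
    · filter_upwards [hopen.mem_nhds hw] with v hv
      exact hWd v.1 v.2 hv
  refine contDiffAt_one_iff.2 ⟨_, _, hopen.mem_nhds ht, fun w hw => ?_, hst⟩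
  exact (((hZc w hw).clm_comp continuousAt_const).add
    ((hWc w hw).clm_comp continuousAt_const)).continuousWithinAt

end IsFlowOf

end Flow

/-! ### Maps that are Lipschitz near a point -/

section LipschitzNear

/-- The map `f` is Lipschitz on a neighborhood of `x`. -/
def LipschitzNear {α β : Type*} [PseudoEMetricSpace α] [PseudoEMetricSpace β] (f : α → β) (x : α) :
    Prop :=
  ∃ K : ℝ≥0, ∃ s ∈ 𝓝 x, LipschitzOnWith K f s

namespace LipschitzNear

variable {α β γ : Type*} [PseudoEMetricSpace α] [PseudoEMetricSpace β] [PseudoEMetricSpace γ]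

theorem of_lipschitzWith {f : α → β} {K : ℝ≥0} (hf : LipschitzWith K f) (x : α) :
    LipschitzNear f x :=
  ⟨K, univ, univ_mem, hf.lipschitzOnWith⟩

theorem continuousAt {f : α → β} {x : α} (hf : LipschitzNear f x) : ContinuousAt f x := by
  obtain ⟨K, s, hs, h⟩ := hf
  exact h.continuousOn.continuousAt hs

theorem comp {g : β → γ} {f : α → β} {x : α} (hg : LipschitzNear g (f x))
    (hf : LipschitzNear f x) : LipschitzNear (fun y => g (f y)) x := by
  have hc := hf.continuousAt
  obtain ⟨Kf, s, hs, hf⟩ := hf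
  obtain ⟨Kg, t, ht, hg⟩ := hg
  exact ⟨Kg * Kf, s ∩ f ⁻¹' t, inter_mem hs (hc ht),
    hg.comp (hf.mono inter_subset_left) fun y hy => hy.2⟩

theorem prodMk {f : α → β} {g : α → γ} {x : α} (hf : LipschitzNear f x) (hg : LipschitzNear g x) :
    LipschitzNear (fun y => (f y, g y)) x := by
  obtain ⟨Kf, s, hs, hf⟩ := hf
  obtain ⟨Kg, t, ht, hg⟩ := hg
  exact ⟨max Kf Kg, s ∩ t, inter_mem hs ht,
    (hf.mono inter_subset_left).prodMk (hg.mono inter_subset_right)⟩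

theorem congr {f g : α → β} {x : α} (hf : LipschitzNear f x) (h : f =ᶠ[𝓝 x] g) :
    LipschitzNear g x := by
  obtain ⟨K, s, hs, hf⟩ := hf
  refine ⟨K, s ∩ {y | f y = g y}, inter_mem hs h, fun y hy z hz => ?_⟩
  rw [← hy.2, ← hz.2]
  exact hf hy.1 hz.1

theorem of_contDiffAt {E F : Type*} [NormedAddCommGroup E] [NormedSpace ℝ E]
    [NormedAddCommGroup F] [NormedSpace ℝ F] {f : E → F} {x : E} (hf : ContDiffAt ℝ 1 f x) :
    LipschitzNear f x :=
  hf.exists_lipschitzOnWith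

end LipschitzNear

end LipschitzNear

/-! ### Inverting families of maps close to the identity -/

section NearIdentity

variable {V : Type*} [NormedAddCommGroup V] {J : Set ℝ} {F S : ℝ → V → V}

theorem norm_sub_le_of_near_identity {f : V → V}
    (hf : ∀ a b, ‖f a - f b - (a - b)‖ ≤ 3 / 4 * ‖a - b‖) (a b : V) :
    ‖a - b‖ ≤ 4 * ‖f a - f b‖ := by
  have h1 : ‖a - b‖ ≤ ‖f a - f b‖ + ‖f a - f b - (a - b)‖ := by
    calc ‖a - b‖ = ‖(f a - f b) - (f a - f b - (a - b))‖ := by congr 1; abel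
      _ ≤ _ := norm_sub_le _ _
  linarith [hf a b]

theorem leftInverse_of_near_identity
    (hF : ∀ t ∈ J, ∀ a b, ‖F t a - F t b - (a - b)‖ ≤ 3 / 4 * ‖a - b‖)
    (hS : ∀ t ∈ J, ∀ q, F t (S t q) = q) {t : ℝ} (ht : t ∈ J) (a : V) : S t (F t a) = a := by
  have := norm_sub_le_of_near_identity (hF t ht) (S t (F t a)) a
  rw [hS t ht] at this
  simpa [sub_eq_zero] using this

theorem continuousAt_inverse_of_near_identity (hJ : IsOpen J)
    (hF : ∀ t ∈ J, ∀ a b, ‖F t a - F t b - (a - b)‖ ≤ 3 / 4 * ‖a - b‖)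
    (hS : ∀ t ∈ J, ∀ q, F t (S t q) = q) {t : ℝ} (ht : t ∈ J) (q : V)
    (hc : ContinuousAt (fun s => F s (S t q)) t) :
    ContinuousAt (fun w : ℝ × V => S w.1 w.2) (t, q) := by
  have h1 : Tendsto (fun w : ℝ × V => 4 * ‖w.2 - F w.1 (S t q)‖) (𝓝 (t, q)) (𝓝 0) := by
    have h2 : ContinuousAt (fun w : ℝ × V => F w.1 (S t q)) (t, q) :=
      ContinuousAt.comp (f := fun w : ℝ × V => w.1) (x := (t, q)) hc continuousAt_fst
    have h3 : ContinuousAt (fun w : ℝ × V => 4 * ‖w.2 - F w.1 (S t q)‖) (t, q) :=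
      continuousAt_const.mul (continuousAt_snd.sub h2).norm
    simpa [ContinuousAt, hS t ht] using h3
  rw [ContinuousAt, tendsto_iff_norm_sub_tendsto_zero]
  refine squeeze_zero' (Eventually.of_forall fun _ => norm_nonneg _) ?_ h1
  filter_upwards [continuousAt_fst (p := (t, q)) (hJ.mem_nhds ht)] with w hw
  have := norm_sub_le_of_near_identity (hF w.1 hw) (S w.1 w.2) (S t q)
  rwa [hS w.1 hw] at this

/-- Each `F t` expands distances by at least `1/4`, so moving `(t, q)` moves `S t q` by at most four
times the change in `q` plus that of `F` at a fixed point, the latter controlled by the Lipschitz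
dependence on time. -/
theorem lipschitzNear_inverse_of_near_identity (hJ : IsOpen J)
    (hF : ∀ t ∈ J, ∀ a b, ‖F t a - F t b - (a - b)‖ ≤ 3 / 4 * ‖a - b‖)
    (hS : ∀ t ∈ J, ∀ q, F t (S t q) = q) {t : ℝ} (ht : t ∈ J) (q : V)
    (hL : LipschitzNear (fun w : ℝ × V => F w.1 w.2) (t, S t q)) :
    LipschitzNear (fun w : ℝ × V => S w.1 w.2) (t, q) := by
  have hc : ContinuousAt (fun s => F s (S t q)) t :=
    ContinuousAt.comp (f := fun s => (s, S t q)) (x := t) hL.continuousAt (by fun_prop)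
  have hSc := continuousAt_inverse_of_near_identity hJ hF hS ht q hc
  obtain ⟨C, s, hs, hLs⟩ := hL
  rw [nhds_prod_eq] at hs
  obtain ⟨s₁, hs₁, s₂, hs₂, hss⟩ := mem_prod_iff.1 hs
  refine ⟨4 * (1 + C), {w | w.1 ∈ s₁ ∧ w.1 ∈ J ∧ S w.1 w.2 ∈ s₂}, ?_, ?_⟩
  · have e1 := continuousAt_fst (p := (t, q)) hs₁
    have e2 := continuousAt_fst (p := (t, q)) (hJ.mem_nhds ht)
    filter_upwards [e1, e2, hSc hs₂] with w h1 h2 h3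
    exact ⟨h1, h2, h3⟩
  · refine LipschitzOnWith.of_dist_le_mul fun w hw v hv => ?_
    have h1 := norm_sub_le_of_near_identity (hF w.1 hw.2.1) (S w.1 w.2) (S v.1 v.2)
    rw [hS w.1 hw.2.1] at h1
    have h2 := hLs.dist_le_mul (v.1, S v.1 v.2) (hss ⟨hv.1, hv.2.2⟩) (w.1, S v.1 v.2)
      (hss ⟨hw.1, hv.2.2⟩)
    simp only [hS v.1 hv.2.1] at h2
    have h3 : dist (v.1, S v.1 v.2) (w.1, S v.1 v.2) ≤ dist w v := by
      rw [Prod.dist_eq, dist_self, dist_comm, max_eq_left dist_nonneg]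
      exact le_max_left _ _
    have h4 : dist w.2 v.2 ≤ dist w v := le_max_right _ _
    have h5 : ‖w.2 - F w.1 (S v.1 v.2)‖ ≤ dist w.2 v.2 + dist v.2 (F w.1 (S v.1 v.2)) := by
      rw [← dist_eq_norm]
      exact dist_triangle _ _ _
    have h6 : (C : ℝ) * dist (v.1, S v.1 v.2) (w.1, S v.1 v.2) ≤ C * dist w v := by gcongr
    rw [dist_eq_norm]
    push_cast
    linarith

variable [NormedSpace ℝ V]

theorem surjective_of_near_identity [CompleteSpace V] {f : V → V}
    (hf : ∀ a b, ‖f a - f b - (a - b)‖ ≤ 3 / 4 * ‖a - b‖) : Function.Surjective f := by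
  have h : ApproximatesLinearOn f (ContinuousLinearEquiv.refl ℝ V : V →L[ℝ] V) univ (3 / 4) :=
    fun a _ b _ => by simpa using hf a b
  refine h.surjective ?_
  rcases subsingleton_or_nontrivial V with hV | hV
  · exact Or.inl hV
  · right
    have : ‖((ContinuousLinearEquiv.refl ℝ V).symm : V →L[ℝ] V)‖₊ = 1 := by
      ext
      exact ContinuousLinearMap.norm_id
    rw [this, inv_one, ← NNReal.coe_lt_coe]
    norm_num

/-- The inverse function theorem for `(t, a) ↦ (t, F t a)`, whose differential is block triangular.
Its space block is within `3/4` of the identity, hence invertible by a Neumann series. -/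
theorem contDiffAt_inverse_of_near_identity [CompleteSpace V] (hJ : IsOpen J)
    (hF : ∀ t ∈ J, ∀ a b, ‖F t a - F t b - (a - b)‖ ≤ 3 / 4 * ‖a - b‖)
    (hS : ∀ t ∈ J, ∀ q, F t (S t q) = q)
    (hC : ∀ t ∈ J, ∀ a, ContDiffAt ℝ 1 (fun w : ℝ × V => F w.1 w.2) (t, a))
    {t : ℝ} (ht : t ∈ J) (q : V) :
    ContDiffAt ℝ 1 (fun w : ℝ × V => S w.1 w.2) (t, q) := by
  have hJV : IsOpen {w : ℝ × V | w.1 ∈ J} := hJ.preimage continuous_fst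
  let Φ : OpenPartialHomeomorph (ℝ × V) (ℝ × V) :=
    { toFun := fun w => (w.1, F w.1 w.2)
      invFun := fun w => (w.1, S w.1 w.2)
      source := {w | w.1 ∈ J}
      target := {w | w.1 ∈ J}
      map_source' := fun w hw => hw
      map_target' := fun w hw => hw
      left_inv' := fun w hw => by
        simp only [leftInverse_of_near_identity hF hS hw]
      right_inv' := fun w hw => by
        simp only [hS w.1 hw]
      open_source := hJV
      open_target := hJV
      continuousOn_toFun := fun w hw =>
        (continuousAt_fst.prodMk (hC w.1 hw w.2).continuousAt).continuousWithinAt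
      continuousOn_invFun := fun w hw => by
        refine (continuousAt_fst.prodMk ?_).continuousWithinAt
        refine continuousAt_inverse_of_near_identity hJ hF hS hw w.2 ?_
        exact ContinuousAt.comp (f := fun s => (s, S w.1 w.2)) (x := w.1)
          (hC w.1 hw _).continuousAt (by fun_prop) }
  set a := S t q with ha
  have hd := ((hC t ht a).differentiableAt one_ne_zero).hasFDerivAt
  set D := fderiv ℝ (fun w : ℝ × V => F w.1 w.2) (t, a) with hD
  have hda : HasFDerivAt (fun b => F t b) (D ∘L ContinuousLinearMap.inr ℝ ℝ V) a :=
    hd.comp a (hasFDerivAt_prodMk_right t a)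
  have hlip : LipschitzWith (3 / 4) (fun b => F t b - b) :=
    LipschitzWith.of_dist_le_mul fun b c => by
      rw [dist_eq_norm, dist_eq_norm]
      calc ‖F t b - b - (F t c - c)‖ = ‖F t b - F t c - (b - c)‖ := by congr 1; abel
        _ ≤ _ := by simpa using hF t ht b c
  have hnorm : ‖ContinuousLinearMap.id ℝ V - D ∘L ContinuousLinearMap.inr ℝ ℝ V‖ < 1 := by
    have h1 := (hda.sub (hasFDerivAt_id a)).le_of_lipschitz hlip
    rw [norm_sub_rev]
    refine h1.trans_lt ?_
    norm_num
  let e' : V ≃L[ℝ] V := ContinuousLinearEquiv.ofUnit (Units.oneSub _ hnorm)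
  have he' : ∀ v, e' v = D (0, v) := fun v => by
    change ((1 : V →L[ℝ] V) - (ContinuousLinearMap.id ℝ V -
      D ∘L ContinuousLinearMap.inr ℝ ℝ V)) v = _
    simp
  let e : (ℝ × V) ≃L[ℝ] (ℝ × V) := (ContinuousLinearEquiv.refl ℝ ℝ).skewProd e'
    (D ∘L ContinuousLinearMap.inl ℝ ℝ V)
  have hΦ : HasFDerivAt Φ (e : (ℝ × V) →L[ℝ] (ℝ × V)) (Φ.symm (t, q)) := by
    have h1 : HasFDerivAt (fun w : ℝ × V => (w.1, F w.1 w.2))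
      ((ContinuousLinearMap.fst ℝ ℝ V).prod D) (t, a) := hasFDerivAt_fst.prodMk hd
    have he : (e : (ℝ × V) →L[ℝ] (ℝ × V)) = (ContinuousLinearMap.fst ℝ ℝ V).prod D := by
      refine ContinuousLinearMap.ext fun w => Prod.ext rfl ?_
      change e' w.2 + D (w.1, 0) = D w
      rw [he', ← map_add]
      simp
    rw [he]
    exact h1
  have h := Φ.contDiffAt_symm (n := 1) (a := (t, q)) ht hΦ
    (contDiffAt_fst.prodMk (hC t ht a))
  exact contDiffAt_snd.comp _ h

end NearIdentity

/-! ### Characteristics and the action -/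

section Characteristics

/-- Second order Taylor estimate for a function with Lipschitz differential. -/
theorem abs_sub_sub_le_of_lipschitz_fderiv {E : Type*} [NormedAddCommGroup E] [NormedSpace ℝ E]
    {f : E → ℝ} {f' : E → E →L[ℝ] ℝ} {C : ℝ} (hC0 : 0 ≤ C) (hf : ∀ x, HasFDerivAt f (f' x) x)
    (hC : ∀ x y, ‖f' x - f' y‖ ≤ C * ‖x - y‖) (x y : E) :
    |f y - f x - f' x (y - x)| ≤ C * ‖y - x‖ ^ 2 := by
  have h := (convex_closedBall x ‖y - x‖).norm_image_sub_le_of_norm_hasFDerivWithin_le'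
    (f := f) (f' := f') (φ := f' x) (C := C * ‖y - x‖) (fun z _ => (hf z).hasFDerivWithinAt)
    (fun z hz => (hC z x).trans (by
      rw [← dist_eq_norm]; gcongr; exact Metric.mem_closedBall.1 hz))
    (Metric.mem_closedBall_self (norm_nonneg _)) (y := y)
    (by rw [Metric.mem_closedBall, dist_eq_norm])
  rw [Real.norm_eq_abs] at h
  linarith

/-- `k w` is both `o(1)` and `O(w - x)`, so its square is `o(w - x)`. -/
theorem hasFDerivAt_zero_of_le_sq {W V : Type*} [NormedAddCommGroup W] [NormedSpace ℝ W]
    [NormedAddCommGroup V] [NormedSpace ℝ V] {r : W → ℝ} {k : W → V} {k' : W →L[ℝ] V} {x : W}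
    {C : ℝ} (hk : HasFDerivAt k k' x) (hk0 : k x = 0)
    (hr : ∀ᶠ w in 𝓝 x, |r w| ≤ C * ‖k w‖ ^ 2) : HasFDerivAt r (0 : W →L[ℝ] ℝ) x := by
  have hrx : r x = 0 := by
    have := hr.self_of_nhds
    rw [hk0] at this
    simpa using this
  have h1 : r =O[𝓝 x] fun w => ‖k w‖ * ‖k w‖ := by
    refine Asymptotics.IsBigO.of_bound C ?_
    filter_upwards [hr] with w hw
    rw [Real.norm_eq_abs, norm_mul, norm_norm]
    linarith
  have h2 : (fun w => ‖k w‖) =o[𝓝 x] fun _ => (1 : ℝ) := by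
    rw [Asymptotics.isLittleO_one_iff]
    have := hk.continuousAt.norm
    rwa [ContinuousAt, hk0, norm_zero] at this
  have h3 : (fun w => ‖k w‖) =O[𝓝 x] fun w => ‖w - x‖ := by
    have := hk.isBigO_sub
    simp only [hk0, sub_zero] at this
    exact this.norm_norm
  refine .of_isLittleO ?_
  have h4 := h1.trans_isLittleO (h2.mul_isBigO h3)
  simp only [one_mul] at h4
  simpa [hrx] using h4.of_norm_right

variable {V : Type*} [NormedAddCommGroup V] [NormedSpace ℝ V]

/-- `X` is the Hamiltonian vector field `(∂_p H, -∂_q H)`. -/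
structure IsHamiltonianField (H : ℝ × V × StrongDual ℝ V → ℝ)
    (X : ℝ × V × StrongDual ℝ V → V × StrongDual ℝ V) : Prop where
  fst : ∀ z ζ, ζ (X z).1 = fderiv ℝ H z (0, 0, ζ)
  snd : ∀ z θ, (X z).2 θ = -fderiv ℝ H z (0, θ, 0)

namespace IsHamiltonianField

variable {H : ℝ × V × StrongDual ℝ V → ℝ} {X : ℝ × V × StrongDual ℝ V → V × StrongDual ℝ V}
  {K : ℝ≥0}

theorem fderiv_apply (hX : IsHamiltonianField H X) (z : ℝ × V × StrongDual ℝ V)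
    (v : V × StrongDual ℝ V) : fderiv ℝ H z (0, v) = v.2 (X z).1 - (X z).2 v.1 := by
  rw [hX.fst, hX.snd, sub_neg_eq_add, ← map_add]
  simp

theorem abs_taylor_le (hX : IsHamiltonianField H X) (hH : ContDiff ℝ 2 H)
    (hlip : ∀ t, LipschitzWith K fun x => X (t, x)) (t : ℝ) (z w : V × StrongDual ℝ V) :
    |H (t, w) - H (t, z) - fderiv ℝ H (t, z) (0, w - z)| ≤ 2 * K * ‖w - z‖ ^ 2 := by
  refine abs_sub_sub_le_of_lipschitz_fderiv (f := fun x => H (t, x))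
    (f' := fun x => fderiv ℝ H (t, x) ∘L ContinuousLinearMap.inr ℝ ℝ (V × StrongDual ℝ V))
    (by positivity) (fun x => ?_) (fun x y => ?_) z w
  · exact ((hH.differentiable two_ne_zero) (t, x)).hasFDerivAt.comp x
      (hasFDerivAt_prodMk_right t x)
  · refine ContinuousLinearMap.opNorm_le_bound _ (by positivity) fun v => ?_
    have e : (fderiv ℝ H (t, x) ∘L ContinuousLinearMap.inr ℝ ℝ (V × StrongDual ℝ V)
        - fderiv ℝ H (t, y) ∘L ContinuousLinearMap.inr ℝ ℝ (V × StrongDual ℝ V)) v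
        = v.2 ((X (t, x) - X (t, y)).1) - ((X (t, x) - X (t, y)).2) v.1 := by
      change fderiv ℝ H (t, x) (0, v) - fderiv ℝ H (t, y) (0, v) = _
      rw [hX.fderiv_apply, hX.fderiv_apply, Prod.fst_sub, Prod.snd_sub, map_sub,
        sub_apply]
      ring
    have hl := (hlip t).dist_le_mul x y
    rw [dist_eq_norm, dist_eq_norm] at hl
    rw [e]
    have h1 : ‖v.2 ((X (t, x) - X (t, y)).1)‖ ≤ ‖v‖ * (K * ‖x - y‖) :=
      (v.2.le_opNorm _).trans (mul_le_mul (norm_snd_le v) ((norm_fst_le _).trans hl)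
        (norm_nonneg _) (norm_nonneg _))
    have h2 : ‖((X (t, x) - X (t, y)).2) v.1‖ ≤ (K * ‖x - y‖) * ‖v‖ :=
      (ContinuousLinearMap.le_opNorm _ _).trans (mul_le_mul ((norm_snd_le _).trans hl)
        (norm_fst_le v) (norm_nonneg _) (by positivity))
    calc _ ≤ _ := norm_sub_le _ _
      _ ≤ _ := add_le_add h1 h2
      _ = _ := by ring

/-- First order expansion of the action with respect to the end point. -/
theorem abs_action_sub_le (hX : IsHamiltonianField H X) (hH : ContDiff ℝ 2 H)
    (hlip : ∀ t, LipschitzWith K fun x => X (t, x)) {t D δ : ℝ} {z w : ℝ → V × StrongDual ℝ V}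
    {A B : ℝ → ℝ}
    (hz : ∀ s, |s| ≤ |t| → HasDerivAt z (X (s, z s)) s)
    (hw : ∀ s, |s| ≤ |t| → HasDerivAt w (X (s, w s)) s)
    (hA : ∀ s, |s| ≤ |t| → HasDerivAt A ((z s).2 (X (s, z s)).1 - H (s, z s)) s)
    (hB : ∀ s, |s| ≤ |t| → HasDerivAt B ((w s).2 (X (s, w s)).1 - H (s, w s)) s)
    (hD : ∀ s, |s| ≤ |t| → ‖w s - z s‖ ≤ D)
    (h0 : |B 0 - A 0 - (z 0).2 ((w 0).1 - (z 0).1)| ≤ δ) :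
    |B t - A t - (z t).2 ((w t).1 - (z t).1)| ≤ δ + 3 * K * D ^ 2 * |t| := by
  have hfst : ∀ {y : ℝ → V × StrongDual ℝ V} {y' s}, HasDerivAt y y' s →
      HasDerivAt (fun s => (y s).1) y'.1 s := fun {_ _ s} h =>
    (ContinuousLinearMap.fst ℝ V (StrongDual ℝ V)).hasFDerivAt.comp_hasDerivAt s h
  have hsnd : ∀ {y : ℝ → V × StrongDual ℝ V} {y' s}, HasDerivAt y y' s →
      HasDerivAt (fun s => (y s).2) y'.2 s := fun {_ _ s} h =>
    (ContinuousLinearMap.snd ℝ V (StrongDual ℝ V)).hasFDerivAt.comp_hasDerivAt s h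
  have h := norm_le_gronwallBound_abs (f := fun s => B s - A s - (z s).2 ((w s).1 - (z s).1))
    (δ := δ) (K := 0) (ε := 3 * K * D ^ 2) (t := t)
    (fun s hs => ((hB s hs).sub (hA s hs)).sub
      ((hsnd (hz s hs)).clm_apply ((hfst (hw s hs)).sub (hfst (hz s hs))))) (fun s hs => ?_) h0
  · rwa [gronwallBound_K0] at h
  · have hT := hX.abs_taylor_le hH hlip s (z s) (w s)
    rw [hX.fderiv_apply] at hT
    have hl := (hlip s).dist_le_mul (w s) (z s)
    rw [dist_eq_norm, dist_eq_norm] at hl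
    have hP : |((w s).2 - (z s).2) ((X (s, w s)).1 - (X (s, z s)).1)|
        ≤ ‖w s - z s‖ * (K * ‖w s - z s‖) :=
      (ContinuousLinearMap.le_opNorm _ _).trans (mul_le_mul (norm_snd_le (w s - z s))
        ((norm_fst_le (X (s, w s) - X (s, z s))).trans hl) (norm_nonneg _) (norm_nonneg _))
    have hsq : K * ‖w s - z s‖ ^ 2 ≤ K * D ^ 2 := by gcongr; exact hD s hs
    -- By Hamilton's equations the linear terms assemble into `dH(w - z)`. What remains is a product
    -- of two differences, of size `K`, and a Taylor remainder, of size `2 * K`: hence `3 * K`.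
    have e : (w s).2 (X (s, w s)).1 - H (s, w s) - ((z s).2 (X (s, z s)).1 - H (s, z s))
          - ((X (s, z s)).2 ((w s).1 - (z s).1) + (z s).2 ((X (s, w s)).1 - (X (s, z s)).1))
        = ((w s).2 - (z s).2) ((X (s, w s)).1 - (X (s, z s)).1)
          - (H (s, w s) - H (s, z s)
            - ((w s - z s).2 (X (s, z s)).1 - (X (s, z s)).2 (w s - z s).1)) := by
      simp only [Prod.fst_sub, Prod.snd_sub, map_sub, sub_apply]
      ring
    rw [zero_mul, zero_add, Real.norm_eq_abs, e]
    refine (abs_sub _ _).trans ?_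
    nlinarith

end IsHamiltonianField

/-- The differential `-H dt + p dq` of a solution of the Hamilton-Jacobi equation with space
differential `p` at the point `(t, q)`. -/
def hamiltonJacobiForm (H : ℝ × V × StrongDual ℝ V → ℝ) (z : ℝ × V × StrongDual ℝ V) :
    ℝ × V →L[ℝ] ℝ :=
  -H z • ContinuousLinearMap.fst ℝ ℝ V + z.2.2 ∘L ContinuousLinearMap.snd ℝ ℝ V

theorem contDiff_hamiltonJacobiForm {H : ℝ × V × StrongDual ℝ V → ℝ} {n : WithTop ℕ∞}
    (hH : ContDiff ℝ n H) : ContDiff ℝ n (hamiltonJacobiForm H) := by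
  refine ContDiff.add (ContDiff.smul hH.neg contDiff_const) ?_
  exact (contDiff_snd.comp contDiff_snd).clm_comp contDiff_const

/-- The product `x * l` is kept together because it is `K|t|(1 + L)`, and not `1 + L`, that is
bounded on `J`. -/
theorem exp_sub_one_mul_le {x l : ℝ} (hx0 : 0 ≤ x) (hx1 : x ≤ 1) (hl : 0 ≤ l) :
    (Real.exp x - 1) * l ≤ (1 + x) * (x * l) := by
  have := (abs_le.1 (Real.abs_exp_sub_one_sub_id_le (abs_le.2 ⟨by linarith, hx1⟩))).2
  calc (Real.exp x - 1) * l ≤ (x + x ^ 2) * l := by gcongr; linarith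
    _ = _ := by ring

/-- Solution of the Hamilton-Jacobi equation by the method of characteristics. -/
theorem exists_hamiltonJacobi_solution [CompleteSpace V] {H : ℝ × V × StrongDual ℝ V → ℝ}
    {X : ℝ × V × StrongDual ℝ V → V × StrongDual ℝ V} {K L : ℝ≥0}
    (hX : IsHamiltonianField H X) (hH : ContDiff ℝ 2 H) (hXC : ContDiff ℝ 1 X)
    (hlip : ∀ t, LipschitzWith K fun x => X (t, x))
    {u₀ : V → ℝ} (hd : Differentiable ℝ u₀) (hL : LipschitzWith L (fderiv ℝ u₀))
    {J : Set ℝ} (hJ : J = {t : ℝ | K * |t| * (1 + L) < 1 / 2}) :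
    ∃ (u : ℝ × V → ℝ) (p : ℝ × V → StrongDual ℝ V),
      (∀ q, u (0, q) = u₀ q) ∧
      (∀ t ∈ J, ∀ q, HasFDerivAt u (hamiltonJacobiForm H (t, q, p (t, q))) (t, q)) ∧
      (∀ t ∈ J, ∀ q, LipschitzNear p (t, q)) ∧
      (∀ t ∈ J, ∀ q q',
        (1 - (Real.exp (K * |t|) - 1) * (1 + L)) * ‖p (t, q) - p (t, q')‖
          ≤ (L + (Real.exp (K * |t|) - 1) * (1 + L)) * ‖q - q'‖) ∧
      (ContDiff ℝ 1 (fderiv ℝ u₀) → ∀ t ∈ J, ∀ q, ContDiffAt ℝ 1 p (t, q)) := by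
  have hJo : IsOpen J := by
    rw [hJ]
    exact isOpen_lt (by fun_prop) continuous_const
  have hL1 : (1 : ℝ) ≤ 1 + L := by linarith [L.2, show (L : ℝ) = L.1 from rfl]
  have h0J : (0 : ℝ) ∈ J := by rw [hJ]; norm_num
  have hJhalf : ∀ t ∈ J, K * |t| < 1 / 2 := by
    intro t ht
    rw [hJ] at ht
    exact lt_of_le_of_lt (le_mul_of_one_le_right (by positivity) hL1) ht
  have hsub : ∀ t ∈ J, ∀ s : ℝ, |s| ≤ |t| → K * |s| < 1 / 2 := fun t ht s hs =>
    (mul_le_mul_of_nonneg_left hs K.2).trans_lt (hJhalf t ht)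
  have h34 : ∀ {x : ℝ}, x < 1 / 2 → x < 3 / 4 := fun h => h.trans (by norm_num)
  -- The flow is taken up to `3/4` so that the linearization and the action, solved up to `1/2`,
  -- have data continuous on the closed interval.
  obtain ⟨Z, hZ⟩ := exists_isFlowOf (c := 3 / 4) (by norm_num) (by norm_num) hXC.continuous hlip
  set ι : V → V × StrongDual ℝ V := fun a => (a, fderiv ℝ u₀ a) with hι
  have hιL : ∀ a b, ‖ι a - ι b‖ ≤ (1 + L) * ‖a - b‖ := by
    intro a b
    have h1 := hL.dist_le_mul a b
    rw [dist_eq_norm, dist_eq_norm] at h1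
    rw [hι, Prod.mk_sub_mk, Prod.norm_mk]
    refine max_le ?_ ?_ <;> nlinarith [norm_nonneg (a - b), L.2, show (L : ℝ) = L.1 from rfl]
  have hdisp : ∀ t ∈ J, ∀ a b, ‖Z t (ι a) - Z t (ι b) - (ι a - ι b)‖
      ≤ (Real.exp (K * |t|) - 1) * (1 + L) * ‖a - b‖ := by
    intro t ht a b
    refine (hZ.norm_sub_sub_le hlip (h34 (hJhalf t ht)) _ _).trans ?_
    rw [mul_assoc]
    have : 0 ≤ Real.exp (K * |t|) - 1 := by
      linarith [Real.add_one_le_exp ((K : ℝ) * |t|), show 0 ≤ (K : ℝ) * |t| by positivity]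
    gcongr
    exact hιL a b
  set F : ℝ → V → V := fun t a => (Z t (ι a)).1 with hFdef
  have hFε : ∀ t ∈ J, ∀ a b, ‖F t a - F t b - (a - b)‖
      ≤ (Real.exp (K * |t|) - 1) * (1 + L) * ‖a - b‖ := fun t ht a b =>
    (norm_fst_le (Z t (ι a) - Z t (ι b) - (ι a - ι b))).trans (hdisp t ht a b)
  have hF : ∀ t ∈ J, ∀ a b, ‖F t a - F t b - (a - b)‖ ≤ 3 / 4 * ‖a - b‖ := by
    intro t ht a b
    refine (hFε t ht a b).trans ?_
    gcongr
    have h1 := hJhalf t ht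
    have h2 := exp_sub_one_mul_le (x := K * |t|) (l := 1 + L) (by positivity) (by linarith)
      (by positivity)
    rw [hJ] at ht
    have h3 : (K : ℝ) * |t| * (1 + L) < 1 / 2 := ht
    have h4 : 0 ≤ (K : ℝ) * |t| * (1 + L) := by positivity
    nlinarith
  choose S' hS' using fun t : J => fun q => surjective_of_near_identity (hF t t.2) q
  classical
  set S : ℝ → V → V := fun t q => if h : t ∈ J then S' ⟨t, h⟩ q else 0 with hSdef
  have hS : ∀ t ∈ J, ∀ q, F t (S t q) = q := by
    intro t ht q
    simp only [hSdef, dif_pos ht]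
    exact hS' ⟨t, ht⟩ q
  have hSF : ∀ t ∈ J, ∀ a, S t (F t a) = a := fun t ht a =>
    leftInverse_of_near_identity hF hS ht a
  -- The action is a primitive, obtained as the solution for a field that ignores the state.
  choose U' hU0 hU using fun a => exists_hasDerivAt_of_lipschitzWith (K := K) (c := 1 / 2)
    (f := fun (t : ℝ) (_ : ℝ) => (Z t (ι a)).2 (X (t, Z t (ι a))).1 - H (t, Z t (ι a)))
    (by norm_num) (by norm_num) (fun t _ => (LipschitzWith.const _).weaken zero_le)
    (fun _ => by
      have h1 : ContinuousOn (fun t => Z t (ι a)) {t : ℝ | K * |t| ≤ 1 / 2} := fun t ht =>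
        (hZ.hasDerivAt (ι a) t (lt_of_le_of_lt ht (by norm_num))).continuousAt.continuousWithinAt
      have h2 : ContinuousOn (fun t => (t, Z t (ι a))) {t : ℝ | K * |t| ≤ 1 / 2} :=
        continuousOn_id.prodMk h1
      exact (h1.snd.clm_apply (hXC.continuous.comp_continuousOn h2).fst).sub
        (hH.continuous.comp_continuousOn h2)) (u₀ a)
  -- `L` comes from the Taylor estimate of `u₀`, and `6 * (1 + L) ^ 2` from `3 * K * D ^ 2 * |t|`
  -- with `D = 2 * (1 + L) * ‖b - a‖` and `K|t| < 1/2`.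
  set C : ℝ := L + 6 * (1 + L) ^ 2 with hC
  have hC0 : 0 ≤ C := by positivity
  have hact : ∀ t ∈ J, ∀ a b, |U' b t - U' a t - (Z t (ι a)).2 (F t b - F t a)|
      ≤ C * ‖b - a‖ ^ 2 := by
    intro t ht a b
    have h1 := hX.abs_action_sub_le hH hlip (t := t) (D := 2 * ((1 + L) * ‖b - a‖))
      (δ := L * ‖b - a‖ ^ 2)
      (z := fun s => Z s (ι a)) (w := fun s => Z s (ι b)) (A := U' a) (B := U' b)
      (fun s hs => hZ.hasDerivAt _ s (h34 (hsub t ht s hs)))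
      (fun s hs => hZ.hasDerivAt _ s (h34 (hsub t ht s hs)))
      (fun s hs => hU a s (hsub t ht s hs)) (fun s hs => hU b s (hsub t ht s hs))
      (fun s hs => (hZ.norm_sub_le hlip (h34 (hsub t ht s hs)) (hsub t ht s hs) _ _).trans
        (by gcongr; exact hιL b a))
      (by
        rw [hU0, hU0, hZ.zero, hZ.zero]
        refine abs_sub_sub_le_of_lipschitz_fderiv L.2 (fun x => (hd x).hasFDerivAt)
          (fun x y => ?_) a b
        have := hL.dist_le_mul x y
        rwa [dist_eq_norm, dist_eq_norm] at this)
    refine h1.trans ?_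
    have h2 : (K : ℝ) * |t| * (12 * ((1 + L) ^ 2 * ‖b - a‖ ^ 2))
        ≤ 1 / 2 * (12 * ((1 + L) ^ 2 * ‖b - a‖ ^ 2)) := by
      gcongr
      exact (hJhalf t ht).le
    rw [hC]
    linarith
  set u : ℝ × V → ℝ := fun w => U' (S w.1 w.2) w.1 with hu
  set p : ℝ × V → StrongDual ℝ V := fun w => (Z w.1 (ι (S w.1 w.2))).2 with hp
  have hexp : ∀ t ∈ J, ∀ a q, |u (t, q) - U' a t - (Z t (ι a)).2 (q - F t a)|
      ≤ 16 * C * ‖q - F t a‖ ^ 2 := by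
    intro t ht a q
    have h1 := hact t ht a (S t q)
    have h2 := norm_sub_le_of_near_identity (hF t ht) (S t q) a
    rw [hS t ht] at h1 h2
    refine h1.trans ?_
    calc C * ‖S t q - a‖ ^ 2 ≤ C * (4 * ‖q - F t a‖) ^ 2 := by gcongr
      _ = _ := by ring
  have hZC : ∀ t ∈ J, ∀ x, ContDiffAt ℝ 1 (fun w : ℝ × V × StrongDual ℝ V => Z w.1 w.2) (t, x) :=
    fun t ht x => hZ.contDiffAt hXC hlip (by norm_num) (hJhalf t ht) x
  have hΓ : ∀ t ∈ J, ∀ a, LipschitzNear (fun w : ℝ × V => Z w.1 (ι w.2)) (t, a) := by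
    intro t ht a
    refine (LipschitzNear.of_contDiffAt (hZC t ht (ι a))).comp
      (f := fun w : ℝ × V => (w.1, ι w.2)) (x := (t, a)) ?_
    refine (LipschitzNear.of_lipschitzWith LipschitzWith.prod_fst _).prodMk ?_
    exact (LipschitzNear.of_lipschitzWith LipschitzWith.prod_snd _).prodMk
      (LipschitzNear.of_lipschitzWith (hL.comp LipschitzWith.prod_snd) _)
  refine ⟨u, p, fun q => ?_, fun t ht q => ?_, fun t ht q => ?_, fun t ht q q' => ?_,
    fun hu₀ t ht q => ?_⟩
  · have h1 : S 0 q = q := by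
      have h2 : F 0 q = q := by simp [hFdef, hZ.zero, hι]
      have := hSF 0 h0J q
      rwa [h2] at this
    simp only [hu, h1, hU0]
  · set a := S t q with ha
    have hZd := (hZ.hasDerivAt (ι a) t (h34 (hJhalf t ht))).hasFDerivAt.comp (t, q)
      (hasFDerivAt_fst (𝕜 := ℝ) (E := ℝ) (F := V))
    have hUd := (hU a t (hJhalf t ht)).hasFDerivAt.comp (t, q)
      (hasFDerivAt_fst (𝕜 := ℝ) (E := ℝ) (F := V))
    have hk := (hasFDerivAt_snd (𝕜 := ℝ) (E := ℝ) (F := V) (p := (t, q))).sub hZd.fst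
    have hk0 : q - F t a = 0 := by rw [ha, hS t ht, sub_self]
    -- The starting point `a` is frozen at `S t q`, so the model is differentiable in `w`; the
    -- remainder is quadratic in `w.2 - F w.1 a`, which vanishes at `(t, q)`.
    have hr := hasFDerivAt_zero_of_le_sq
      (r := fun w : ℝ × V => u w - U' a w.1 - (Z w.1 (ι a)).2 (w.2 - F w.1 a)) (C := 16 * C)
      (k := fun w : ℝ × V => w.2 - F w.1 a) hk hk0 (by
        filter_upwards [continuousAt_fst (p := (t, q)) (hJo.mem_nhds ht)] with w hw
        exact hexp w.1 hw a w.2)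
    have hg := hUd.add (hZd.snd.clm_apply hk)
    have htot := hg.add hr
    have e1 : (fun w : ℝ × V => U' a w.1 + (Z w.1 (ι a)).2 (w.2 - F w.1 a)
        + (u w - U' a w.1 - (Z w.1 (ι a)).2 (w.2 - F w.1 a))) = u := by
      funext w; ring
    have htot' := htot.congr_of_eventuallyEq (f₁ := u)
      (Eventually.of_forall fun w => (congrFun e1 w).symm)
    refine htot'.congr_fderiv ?_
    refine ContinuousLinearMap.ext fun w => ?_
    have hq : (t, q, (Z t (ι a)).2) = (t, Z t (ι a)) := by
      rw [Prod.mk.injEq]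
      exact ⟨rfl, Prod.ext (sub_eq_zero.1 hk0) rfl⟩
    simp only [hamiltonJacobiForm, hp, ← ha, hq]
    have hk0' : q - (Z t (ι a)).1 = 0 := hk0
    simp [hk0']
    ring
  · have hSn : LipschitzNear (fun w : ℝ × V => S w.1 w.2) (t, q) :=
      lipschitzNear_inverse_of_near_identity hJo hF hS ht q
        ((LipschitzNear.of_lipschitzWith LipschitzWith.prod_fst _).comp (hΓ t ht (S t q)))
    exact (LipschitzNear.of_lipschitzWith LipschitzWith.prod_snd _).comp
      ((hΓ t ht (S t q)).comp (f := fun w : ℝ × V => (w.1, S w.1 w.2)) (x := (t, q))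
        ((LipschitzNear.of_lipschitzWith LipschitzWith.prod_fst _).prodMk hSn))
  · set ε := (Real.exp (K * |t|) - 1) * (1 + L) with hε
    set a := S t q with ha
    set b := S t q' with hb
    have h1 := hFε t ht a b
    rw [ha, hb, hS t ht, hS t ht, ← ha, ← hb] at h1
    have h2 : (1 - ε) * ‖a - b‖ ≤ ‖q - q'‖ := by
      have : ‖a - b‖ ≤ ‖q - q'‖ + ‖q - q' - (a - b)‖ := by
        calc ‖a - b‖ = ‖(q - q') - (q - q' - (a - b))‖ := by congr 1; abel
          _ ≤ _ := norm_sub_le _ _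
      linarith
    have h3 : ‖p (t, q) - p (t, q')‖ ≤ (L + ε) * ‖a - b‖ := by
      have h4 : ‖p (t, q) - p (t, q') - (fderiv ℝ u₀ a - fderiv ℝ u₀ b)‖ ≤ ε * ‖a - b‖ :=
        (norm_snd_le (Z t (ι a) - Z t (ι b) - (ι a - ι b))).trans (hdisp t ht a b)
      have h5 := hL.dist_le_mul a b
      rw [dist_eq_norm, dist_eq_norm] at h5
      calc ‖p (t, q) - p (t, q')‖
          = ‖(p (t, q) - p (t, q') - (fderiv ℝ u₀ a - fderiv ℝ u₀ b))
              + (fderiv ℝ u₀ a - fderiv ℝ u₀ b)‖ := by congr 1; abel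
        _ ≤ _ := norm_add_le _ _
        _ ≤ _ := add_le_add h4 h5
        _ = _ := by ring
    have hε0 : 0 ≤ ε := by
      have : 0 ≤ Real.exp (K * |t|) - 1 := by
        linarith [Real.add_one_le_exp ((K : ℝ) * |t|), show 0 ≤ (K : ℝ) * |t| by positivity]
      positivity
    rcases le_total 0 (1 - ε) with h1ε | h1ε
    · calc (1 - ε) * ‖p (t, q) - p (t, q')‖ ≤ (1 - ε) * ((L + ε) * ‖a - b‖) := by gcongr
        _ = (L + ε) * ((1 - ε) * ‖a - b‖) := by ring
        _ ≤ _ := by gcongr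
    · exact (mul_nonpos_of_nonpos_of_nonneg h1ε (norm_nonneg _)).trans (by positivity)
  · have hΓC : ∀ t ∈ J, ∀ a, ContDiffAt ℝ 1 (fun w : ℝ × V => Z w.1 (ι w.2)) (t, a) := by
      intro t ht a
      refine (hZC t ht (ι a)).comp (f := fun w : ℝ × V => (w.1, ι w.2)) (t, a) ?_
      exact contDiffAt_fst.prodMk (contDiffAt_snd.prodMk
        (hu₀.contDiffAt.comp (t, a) contDiffAt_snd))
    have hSC : ContDiffAt ℝ 1 (fun w : ℝ × V => S w.1 w.2) (t, q) :=
      contDiffAt_inverse_of_near_identity hJo hF hS (fun t ht a => (hΓC t ht a).fst) ht q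
    exact ((hΓC t ht (S t q)).comp (f := fun w : ℝ × V => (w.1, S w.1 w.2)) (t, q)
      (contDiffAt_fst.prodMk hSC)).snd

end Characteristics

/-! ### From the Hessian bound to the Hamiltonian field -/

/-- The mean value inequality with `w` fixed: `w` can then be measured in the Euclidean norm while
`v` uses the maximum norm, so `√2` is lost only once. -/
theorem abs_apply_sub_le_of_partial_fderiv_le {A B W : Type*} [NormedAddCommGroup A]
    [NormedSpace ℝ A] [NormedAddCommGroup B] [NormedSpace ℝ B] [NormedAddCommGroup W]
    [NormedSpace ℝ W] {G : A × B → W →L[ℝ] ℝ} (hG : Differentiable ℝ G) {w : W} {t : A} {C : ℝ}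
    (hC : 0 ≤ C) (hb : ∀ z v, |fderiv ℝ G (t, z) (0, v) w| ≤ C * ‖v‖) (x y : B) :
    |(G (t, x) - G (t, y)) w| ≤ C * ‖x - y‖ := by
  have hder : ∀ z, HasFDerivAt (fun x => G (t, x) w) (ContinuousLinearMap.apply ℝ ℝ w ∘L
      (fderiv ℝ G (t, z) ∘L ContinuousLinearMap.inr ℝ A B)) z := fun z =>
    (ContinuousLinearMap.apply ℝ ℝ w).hasFDerivAt.comp z
      ((hG (t, z)).hasFDerivAt.comp z (hasFDerivAt_prodMk_right t z))
  exact convex_univ.norm_image_sub_le_of_norm_hasFDerivWithin_le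
    (fun z _ => (hder z).hasFDerivWithinAt)
    (fun z _ => ContinuousLinearMap.opNorm_le_bound _ hC (hb z)) (mem_univ y) (mem_univ x)

namespace HJ

theorem lip_le {X Y : Type*} [PseudoEMetricSpace X] [PseudoEMetricSpace Y] {f : X → Y} {K : ℝ≥0}
    (hf : LipschitzWith K f) : lip f ≤ K :=
  iInf₂_le K hf

/-- The best Lipschitz constant of a Lipschitz map is a Lipschitz constant. -/
theorem exists_lip_eq {X Y : Type*} [PseudoMetricSpace X] [PseudoMetricSpace Y] {f : X → Y}
    {K : ℝ≥0} (hf : LipschitzWith K f) : ∃ L : ℝ≥0, lip f = L ∧ LipschitzWith L f := by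
  have hfin : lip f ≠ ∞ := ne_top_of_le_ne_top ENNReal.coe_ne_top (lip_le hf)
  refine ⟨(lip f).toNNReal, (ENNReal.coe_toNNReal hfin).symm, LipschitzWith.of_dist_le_mul ?_⟩
  intro x y
  rcases (dist_nonneg (x := x) (y := y)).eq_or_lt with h | h
  · have := hf.dist_le_mul x y
    rw [← h, mul_zero] at this ⊢
    exact this
  · rw [← div_le_iff₀ h]
    have h1 : ENNReal.ofReal (dist (f x) (f y) / dist x y) ≤ lip f := by
      refine le_iInf₂ fun K' hK' => ?_
      rw [← ENNReal.ofReal_coe_nnreal]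
      exact ENNReal.ofReal_le_ofReal ((div_le_iff₀ h).2 (hK'.dist_le_mul x y))
    exact (ENNReal.ofReal_le_iff_le_toReal hfin).1 h1

variable {d : ℕ}

theorem euclNorm_snd_le (v : Pos d × Mom d) : euclNorm (0, v) ≤ 71 / 50 * ‖v‖ := by
  refine Real.sqrt_le_iff.2 ⟨by positivity, ?_⟩
  have h1 : ‖v.1‖ ^ 2 ≤ ‖v‖ ^ 2 := by gcongr; exact norm_fst_le v
  have h2 : ‖v.2‖ ^ 2 ≤ ‖v‖ ^ 2 := by gcongr; exact norm_snd_le v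
  simp only [norm_zero]
  nlinarith [sq_nonneg ‖v‖]

theorem euclNorm_pos (θ : Pos d) : euclNorm ((0 : ℝ), θ, (0 : Mom d)) = ‖θ‖ := by
  simp [euclNorm]

theorem euclNorm_mom (ζ : Mom d) : euclNorm ((0 : ℝ), (0 : Pos d), ζ) = ‖ζ‖ := by
  simp [euclNorm]

theorem HessianBoundedBy.abs_fderiv_sub_le {H : ℝ × Pos d × Mom d → ℝ} {M : ℝ≥0}
    (hM : HessianBoundedBy H M) (hH : ContDiff ℝ 2 H) (t : ℝ) (x y : Pos d × Mom d)
    (w : ℝ × Pos d × Mom d) :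
    |(fderiv ℝ H (t, x) - fderiv ℝ H (t, y)) w| ≤ 71 / 50 * M * ‖x - y‖ * euclNorm w := by
  have hw : 0 ≤ euclNorm w := Real.sqrt_nonneg _
  have h := abs_apply_sub_le_of_partial_fderiv_le (G := fderiv ℝ H) (w := w) (t := t)
    (C := 71 / 50 * M * euclNorm w)
    ((hH.fderiv_right (m := 1) (by norm_num)).differentiable one_ne_zero) (by positivity)
    (fun z v => by
      refine (hM (t, z) (0, v) w).trans ?_
      calc M * euclNorm (0, v) * euclNorm w ≤ M * (71 / 50 * ‖v‖) * euclNorm w := by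
            gcongr; exact euclNorm_snd_le v
        _ = _ := by ring) x y
  linarith

/-- The isometry of the bidual of `ℝ^d` with `ℝ^d`. -/
theorem exists_bidual_isometry (d : ℕ) : ∃ j : StrongDual ℝ (Mom d) ≃ₗᵢ[ℝ] Pos d,
    ∀ (φ : StrongDual ℝ (Mom d)) (ζ : Mom d), ζ (j φ) = φ ζ := by
  have h1 : ∀ (W : Type) [NormedAddCommGroup W] [NormedSpace ℝ W] [FiniteDimensional ℝ W],
      Module.finrank ℝ (StrongDual ℝ W) = Module.finrank ℝ W := fun W _ _ _ => by
    rw [← (LinearMap.toContinuousLinearMap (𝕜 := ℝ) (E := W) (F' := ℝ)).finrank_eq]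
    exact Subspace.dual_finrank_eq
  let i : Pos d ≃ₗᵢ[ℝ] StrongDual ℝ (Mom d) :=
    (NormedSpace.inclusionInDoubleDualLi ℝ (E := Pos d)).toLinearIsometryEquiv
      (by rw [h1, h1])
  refine ⟨i.symm, fun φ ζ => ?_⟩
  calc ζ (i.symm φ) = i (i.symm φ) ζ := rfl
    _ = φ ζ := by rw [i.apply_symm_apply]

theorem exists_isHamiltonianField {H : ℝ × Pos d × Mom d → ℝ} {M : ℝ≥0}
    (hM : HessianBoundedBy H M) (hH : ContDiff ℝ 2 H) :
    ∃ X, IsHamiltonianField H X ∧ ContDiff ℝ 1 X ∧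
      ∀ t, LipschitzWith (71 / 50 * M) fun x => X (t, x) := by
  obtain ⟨j, hj⟩ := exists_bidual_isometry d
  have hD : ContDiff ℝ 1 (fderiv ℝ H) := hH.fderiv_right (m := 1) (by norm_num)
  let i₁ : Pos d →L[ℝ] ℝ × Pos d × Mom d :=
    ContinuousLinearMap.inr ℝ ℝ (Pos d × Mom d) ∘L ContinuousLinearMap.inl ℝ (Pos d) (Mom d)
  let i₂ : Mom d →L[ℝ] ℝ × Pos d × Mom d :=
    ContinuousLinearMap.inr ℝ ℝ (Pos d × Mom d) ∘L ContinuousLinearMap.inr ℝ (Pos d) (Mom d)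
  refine ⟨fun z => (j (fderiv ℝ H z ∘L i₂), -(fderiv ℝ H z ∘L i₁)), ⟨fun z ζ => ?_, fun z θ => ?_⟩,
    ?_, fun t => LipschitzWith.of_dist_le_mul fun x y => ?_⟩
  · rw [hj]
    rfl
  · rfl
  · exact (j.contDiff.comp (hD.clm_comp (contDiff_const (c := i₂)))).prodMk
      (hD.clm_comp (contDiff_const (c := i₁))).neg
  · rw [Prod.dist_eq, dist_neg_neg, j.dist_map, dist_eq_norm, dist_eq_norm, dist_eq_norm,
      ← ContinuousLinearMap.sub_comp, ← ContinuousLinearMap.sub_comp]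
    push_cast
    refine max_le ?_ ?_
    · refine ContinuousLinearMap.opNorm_le_bound _ (by positivity) fun ζ => ?_
      have := hM.abs_fderiv_sub_le hH t x y (0, 0, ζ)
      rwa [euclNorm_mom] at this
    · refine ContinuousLinearMap.opNorm_le_bound _ (by positivity) fun θ => ?_
      have := hM.abs_fderiv_sub_le hH t x y (0, θ, 0)
      rwa [euclNorm_pos] at this

/-! ### Explicit constants and conclusion -/

theorem enorm_le_inv_iff {M L : ℝ≥0} {t : ℝ} :
    ‖t‖ₑ ≤ (4 * (M : ℝ≥0∞) * (1 + (L : ℝ≥0∞)))⁻¹ ↔ |t| * (4 * M * (1 + L)) ≤ 1 := by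
  rw [ENNReal.le_inv_iff_mul_le, enorm_eq_nnnorm, ← Real.norm_eq_abs, ← coe_nnnorm]
  norm_cast

/-- Comparison of the Lipschitz constants given by Grönwall's inequality with explicit ones. -/
theorem le_mul_of_exp_bound {M L t a b : ℝ} (hM : 0 ≤ M) (hL : 0 ≤ L)
    (ht : |t| * (4 * M * (1 + L)) ≤ 1) (hb : 0 ≤ b)
    (h : (1 - (Real.exp (71 / 50 * M * |t|) - 1) * (1 + L)) * a
      ≤ (L + (Real.exp (71 / 50 * M * |t|) - 1) * (1 + L)) * b) :
    a ≤ (L + 4 * |t| * M * (1 + L) ^ 2) * b := by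
  set m := M * |t| * (1 + L) with hm
  have hm0 : 0 ≤ m := by positivity
  have hm1 : m ≤ 1 / 4 := by rw [hm]; linarith
  set x := 71 / 50 * M * |t| with hx
  have hx0 : 0 ≤ x := by positivity
  have hxm : x * (1 + L) = 71 / 50 * m := by rw [hx, hm]; ring
  have hx1 : x ≤ 71 / 200 := by nlinarith
  set ε := (Real.exp x - 1) * (1 + L) with hε
  have hε1 : ε ≤ 271 / 200 * (71 / 50 * m) := by
    have := exp_sub_one_mul_le hx0 (by linarith) (show 0 ≤ 1 + L by linarith)
    rw [hxm] at this
    refine this.trans ?_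
    gcongr
    linarith
  -- Numerically `ε ≤ 1.925 * m` with `m ≤ 1/4`; thus `ε ≤ 1/2` and `ε ≤ 2 * m ≤ 4 * m * (1 - ε)`,
  -- which is what the next step needs.
  have hε2 : ε ≤ 1 / 2 := by linarith
  have hC : (L + ε) ≤ (1 - ε) * (L + 4 * m * (1 + L)) := by
    have : 0 ≤ (4 * m * (1 - ε) - ε) * (1 + L) := by
      refine mul_nonneg ?_ (by linarith)
      nlinarith
    linarith
  have h2 : (1 - ε) * a ≤ (1 - ε) * ((L + 4 * m * (1 + L)) * b) := by
    rw [← mul_assoc]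
    exact h.trans (by gcongr)
  have h3 := le_of_mul_le_mul_left h2 (by linarith)
  have e : 4 * |t| * M * (1 + L) ^ 2 = 4 * m * (1 + L) := by rw [hm]; ring
  rwa [e]

theorem hamiltonJacobiForm_comp_inr (H : ℝ × Pos d × Mom d → ℝ) (z : ℝ × Pos d × Mom d) :
    hamiltonJacobiForm H z ∘L ContinuousLinearMap.inr ℝ ℝ (Pos d) = z.2.2 := by
  ext v
  simp [hamiltonJacobiForm]

theorem hamiltonJacobiForm_one_zero (H : ℝ × Pos d × Mom d → ℝ) (z : ℝ × Pos d × Mom d) :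
    hamiltonJacobiForm H z (1, 0) = -H z := by
  simp [hamiltonJacobiForm]

end HJ

theorem mainTheorem4 (d : ℕ) (H : ℝ × HJ.Pos d × HJ.Mom d → ℝ) (hH : ContDiff ℝ 2 H)
    (M : ℝ≥0) (hM : HJ.HessianBoundedBy H M)
    (u₀ : HJ.Pos d → ℝ) (hu₀ : HJ.IsC11 u₀)
    (T : ℝ≥0∞) (hT : T = (4 * (M : ℝ≥0∞) * (1 + HJ.lip (fderiv ℝ u₀)))⁻¹) :
    0 < T ∧
    ∃ u : ℝ × HJ.Pos d → ℝ,
      HJ.IsC11LocOn u (HJ.strip d T) ∧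
      HJ.SolvesHJOn H u (HJ.strip d T) ∧
      (∀ q, u (0, q) = u₀ q) ∧
      ContinuousOn u (HJ.closedStrip d T) ∧
      (∀ t : ℝ, ‖t‖ₑ ≤ T →
        Differentiable ℝ (fun q => u (t, q)) ∧
        HJ.lip (fderiv ℝ (fun q => u (t, q))) ≤
          HJ.lip (fderiv ℝ u₀)
            + 4 * ‖t‖ₑ * (M : ℝ≥0∞) * (1 + HJ.lip (fderiv ℝ u₀)) ^ 2) ∧
      (ContDiff ℝ 2 u₀ → ContDiffOn ℝ 2 u (HJ.strip d T)) := by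
  obtain ⟨hd, K₀, hK₀⟩ := hu₀
  obtain ⟨L, hLeq, hL⟩ := HJ.exists_lip_eq hK₀
  rw [hLeq] at hT ⊢
  obtain ⟨X, hX, hXC, hXlip⟩ := HJ.exists_isHamiltonianField hM hH
  obtain ⟨u, p, hu0, hu, hpL, hpB, hpC⟩ := exists_hamiltonJacobi_solution hX hH hXC hXlip hd hL rfl
  have htime : ∀ t : ℝ, ‖t‖ₑ ≤ T → |t| * (4 * M * (1 + L)) ≤ 1 := fun t ht => by
    rwa [hT, HJ.enorm_le_inv_iff] at ht
  -- The closed strip fits strictly inside `J`, since `71/50 * 1/4 < 1/2`.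
  have hJ : ∀ t : ℝ, ‖t‖ₑ ≤ T →
      t ∈ {t : ℝ | ((71 / 50 * M : ℝ≥0) : ℝ) * |t| * (1 + L) < 1 / 2} := fun t ht => by
    have := htime t ht
    simp only [mem_ofPred_eq, NNReal.coe_mul]
    push_cast
    linarith
  have hfd : ∀ z : ℝ × HJ.Pos d, ‖z.1‖ₑ ≤ T →
      HasFDerivAt u (hamiltonJacobiForm H (z.1, z.2, p z)) z := fun z hz => hu z.1 (hJ z.1 hz) z.2
  have hspace : ∀ t : ℝ, ‖t‖ₑ ≤ T → ∀ q, HasFDerivAt (fun y => u (t, y)) (p (t, q)) q := by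
    intro t ht q
    have h := (hfd (t, q) ht).comp q (hasFDerivAt_prodMk_right t q)
    rwa [HJ.hamiltonJacobiForm_comp_inr] at h
  have hopen : IsOpen (HJ.strip d T) :=
    isOpen_lt (continuous_enorm.comp continuous_fst) continuous_const
  have hform : ContDiff ℝ 1 (hamiltonJacobiForm H) :=
    contDiff_hamiltonJacobiForm (hH.of_le (by norm_num))
  have hev : ∀ z ∈ HJ.strip d T,
      (fun z : ℝ × HJ.Pos d => hamiltonJacobiForm H (z.1, z.2, p z)) =ᶠ[𝓝 z] fderiv ℝ u := by
    intro z hz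
    filter_upwards [hopen.mem_nhds hz] with w hw
    exact (hfd w (le_of_lt hw)).fderiv.symm
  refine ⟨?_, u, ⟨fun z hz => (hfd z (le_of_lt hz)).differentiableAt, fun z hz => ?_⟩,
    fun t q htq => ?_, hu0, fun z hz => (hfd z hz).continuousAt.continuousWithinAt,
    fun t ht => ⟨fun q => (hspace t ht q).differentiableAt, ?_⟩, fun hC2 => ?_⟩
  · rw [hT, ENNReal.inv_pos]
    finiteness
  · have h1 : LipschitzNear (fun z : ℝ × HJ.Pos d => (z.1, z.2, p z)) z :=
      (LipschitzNear.of_lipschitzWith LipschitzWith.prod_fst _).prodMk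
        ((LipschitzNear.of_lipschitzWith LipschitzWith.prod_snd _).prodMk
          (hpL z.1 (hJ z.1 (le_of_lt hz)) z.2))
    obtain ⟨K, s, hs, hLs⟩ :=
      ((LipschitzNear.of_contDiffAt hform.contDiffAt).comp h1).congr (hev z hz)
    exact ⟨K, s, mem_nhdsWithin_of_mem_nhds hs, hLs⟩
  · have ht : ‖t‖ₑ ≤ T := le_of_lt htq
    have h1 : HasDerivAt (fun s => u (s, q)) (hamiltonJacobiForm H (t, q, p (t, q)) (1, 0)) t :=
      (hfd (t, q) ht).comp_hasDerivAt t ((hasDerivAt_id t).prodMk (hasDerivAt_const t q))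
    rw [h1.deriv, (hspace t ht q).fderiv, HJ.hamiltonJacobiForm_one_zero, neg_add_cancel]
  · have h1 : LipschitzWith (L + 4 * ‖t‖₊ * M * (1 + L) ^ 2)
        (fderiv ℝ fun q => u (t, q)) := by
      refine LipschitzWith.of_dist_le_mul fun q q' => ?_
      rw [(hspace t ht q).fderiv, (hspace t ht q').fderiv, dist_eq_norm, dist_eq_norm]
      have h2 := hpB t (hJ t ht) q q'
      push_cast at h2 ⊢
      rw [Real.norm_eq_abs]
      exact HJ.le_mul_of_exp_bound M.2 L.2 (htime t ht) (norm_nonneg _) h2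
    refine (HJ.lip_le h1).trans (le_of_eq ?_)
    rw [enorm_eq_nnnorm]
    norm_cast
  · have hp : ∀ z ∈ HJ.strip d T, ContDiffAt ℝ 1 p z := fun z hz =>
      hpC (hC2.fderiv_right (by norm_num)) z.1 (hJ z.1 (le_of_lt hz)) z.2
    suffices h : ContDiffOn ℝ (1 + 1) u (HJ.strip d T) by rwa [one_add_one_eq_two] at h
    refine (contDiffOn_succ_iff_fderiv_of_isOpen hopen).2
      ⟨fun z hz => (hfd z (le_of_lt hz)).differentiableAt.differentiableWithinAt, by simp,
        fun z hz => ?_⟩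
    have h1 : ContDiffAt ℝ 1 (fun z : ℝ × HJ.Pos d => hamiltonJacobiForm H (z.1, z.2, p z)) z :=
      hform.contDiffAt.comp z (contDiffAt_fst.prodMk (contDiffAt_snd.prodMk (hp z hz)))
    exact (h1.congr_of_eventuallyEq (hev z hz).symm).contDiffWithinAt
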